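/- **Notation.** Let $d\in\mathbb N$; write $\partial_I$ ($I\in\mathbb N^d$) for multi-index derivatives, $f\star g$ for convolution on $\mathbb R^d$, and $\hat f(\xi)=\int_{\mathbb R^d}f(x)e^{-\mathrm i\,\xi\cdot x}\,dx$. For $\epsilon>0$ let $\mathbb R^d_\epsilon=\{x+\mathrm iy: x,y\in\mathbb R^d,\ \|y\|<\epsilon\}\subseteq\mathbb C^d$. A *convenient analytical setting* consists of a complex linear space $\mathcal C\subseteq C^\infty(\mathbb R^d,\mathbb C)$ of functions (integrable, so that Fourier transforms make sense), a set $\mathcal D\subseteq\mathbb C[\![\partial_1,\dots,\partial_d]\!]$, and a $\mathbb C$-linear action of the operators $D=\sum_I c_I\partial_I\in\mathcal D$ on functions, such that 1. $\mathcal C$ is closed under pointwise products; 2. $\mathcal D$ is closed under composition (the product of power series) and contains $1$, and is thus a unital commutative ring; 3. $\mathcal D$ contains $\mathbb R[\partial_1,\dots,\partial_d]$ as a subring; 4. $\mathcal D\,\mathcal C\subseteq\mathcal C$, and $\mathcal C$ is a module over $\mathcal D$; real polynomials in the $\partial_j$ act as the usual differential operators, and for each $D=\sum_I c_I\partial_I\in\mathcal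 D$ there is a neighbourhood $U$ of $0$ such that $\widehat{Df}(\xi)=\sum_I c_I\,\widehat{\partial_If}(\xi)$ for all $f\in\mathcal C$ and $\xi\in U$, the sum over $I\in\mathbb N^d$ converging unconditionally; 5. the analytic Leibniz rule $D(fg)=\sum_{I,I'}\binom{I+I'}{I}c_{I+I'}(\partial_If)(\partial_{I'}g)$ holds pointwise near the origin in Fourier space, with the finitely many terms having the same $I+I'$ grouped together: for each $D=\sum_I c_I\partial_I\in\mathcal D$ there is a neighbourhood $U$ of $0$ such that for all $f,g\in\mathcal C$ and $\xi\in U$ $$\widehat{D(fg)}(\xi)=\sum_{J\in\mathbb N^d}\ \sum_{I+I'=J}\binom{I+I'}{I}\,c_{I+I'}\,\widehat{(\partial_If)(\partial_{I'}g)}(\xi),$$ the sum over $J$ converging unconditionally; 6. $\mathcal C\otimes_{\mathcal D}\mathcal C\cong\mathcal C$ by convolution: there is an isomorphism of $\mathcal D$-modules from $\mathcal C\otimes_{\mathcal D}\mathcal C$ onto $\mathcal C$ with $f\otimes g\mapsto f\star g$ (and these convolution integrals converge everywhere); 7. $\mathcal C$ is dense in $C^\infty(\mathbb R^d,\mathbb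 C)$ for the Fréchet topology, i.e. uniform convergence of all derivatives on compact sets. **Theorem.** Let $\mathcal C_0$ be the space of functions $f:\mathbb R^d\to\mathbb C$ for which there are $\epsilon,\delta,K>0$ such that $f$ extends analytically to $\mathbb R^d_\epsilon$ with $|f(x+\mathrm iy)|\le Ke^{-\delta\|x\|}$ there, and let $$\mathcal C=\{f\in C^\infty(\mathbb R^d,\mathbb C): \partial_If\in\mathcal C_0\text{ for all }I\in\mathbb N^d\}.$$ Let $\mathcal P_0$ be the space of functions $p:\mathbb R^d\to\mathbb C$ for which there is $\epsilon>0$ such that $p$ extends analytically to $\mathbb R^d_\epsilon$ and for every $\delta>0$ there is $C_\delta>0$ with $|p(x+\mathrm iy)|\le C_\delta e^{\delta\|x\|}$ there. A symbol $p\in\mathcal P_0$ defines the pseudo-differential operator $$f\mapsto\Big(x\mapsto(2\pi)^{-d}\int_{\mathbb R^d}p(\xi)\hat f(\xi)e^{\mathrm i\,\xi\cdot x}\,d\xi\Big),$$ i.e. multiplication by $p$ in Fourier space; its formal power series is $\sum_I(-\mathrm i)^{|I|}\frac{(\partial_Ip)(0)}{I!}\,\partial_I$. Let $\mathcal D_0\subseteq\mathbb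 C[\![\partial_1,\dots,\partial_d]\!]$ be the set of these power series, and let $$\mathcal D=\Big\{\sum_{k=1}^np_kq_k: n\in\mathbb N,\ p_k\in\mathcal D_0,\ q_k\in\mathbb R[\partial_1,\dots,\partial_d]\Big\}.$$ Then $(\mathcal C,\mathcal D)$, with the elements of $\mathcal D_0$ acting as the above pseudo-differential operators, is a convenient analytical setting. -/

import Mathlib

open MeasureTheory Topology
open scoped ContDiff TensorProduct

noncomputable section

namespace ConvAn

/-- Euclidean space `ℝ^d`. -/
abbrev E (d : ℕ) : Type := EuclideanSpace ℝ (Fin d)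

/-- Hermitian space `ℂ^d`. -/
abbrev EC (d : ℕ) : Type := EuclideanSpace ℂ (Fin d)

/-- The real part `x` of `z = x + iy`. -/
def rePart {d : ℕ} (z : EC d) : E d := WithLp.toLp 2 fun i => (z i).re

/-- The imaginary part `y` of `z = x + iy`. -/
def imPart {d : ℕ} (z : EC d) : E d := WithLp.toLp 2 fun i => (z i).im

/-- The inclusion `ℝ^d ⊆ ℂ^d`. -/
def toComplex {d : ℕ} (x : E d) : EC d := WithLp.toLp 2 fun i => (x i : ℂ)

/-- The open tube `{x + iy : ‖y‖ < ε}` around the real hyperplane. -/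
def tube (d : ℕ) (ε : ℝ) : Set (EC d) := {z | ‖imPart z‖ < ε}

/-- The partial derivative `∂_i f`. -/
def partialDeriv {d : ℕ} (i : Fin d) (f : E d → ℂ) : E d → ℂ :=
  fun x => fderiv ℝ f x (EuclideanSpace.single i 1)

/-- The multi-index derivative `∂_I f = ∂_1^{I_1} ⋯ ∂_d^{I_d} f`. -/
def multiDeriv {d : ℕ} (I : Fin d →₀ ℕ) (f : E d → ℂ) : E d → ℂ :=
  (List.finRange d).foldr (fun i g => (partialDeriv i)^[I i] g) f

/-- The multi-index binomial coefficient `∏ i, (J_i choose I_i)`. -/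
def multiChoose {d : ℕ} (J I : Fin d →₀ ℕ) : ℕ := ∏ i, (J i).choose (I i)

/-- The Fourier transform `ξ ↦ ∫ f(x) e^{-i⟨ξ, x⟩} dx`. -/
def fourierT {d : ℕ} (f : E d → ℂ) (ξ : E d) : ℂ :=
  ∫ x : E d, Complex.exp (-(Complex.I * (inner ℝ ξ x : ℝ))) * f x

/-- The pseudo-differential operator with symbol `p`, that is, multiplication by `p` in Fourier
space: `x ↦ (2π)^{-d} ∫ p(ξ) f̂(ξ) e^{i⟨ξ, x⟩} dξ`. -/
def pseudoDiff {d : ℕ} (p f : E d → ℂ) (x : E d) : ℂ :=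
  ((2 * Real.pi : ℝ) : ℂ)⁻¹ ^ d *
    ∫ ξ : E d, Complex.exp (Complex.I * (inner ℝ ξ x : ℝ)) * (p ξ * fourierT f ξ)

/-- The formal power series `∑ c_I ∂_I` of the pseudo-differential operator with symbol `p`.
As `∂_j` is multiplication by `i ξ_j` in Fourier space, the Taylor expansion
`p(ξ) = ∑ (∂_I p)(0) / I! · ξ^I` gives `c_I = (-i)^{|I|} (∂_I p)(0) / I!`. -/
def symbolSeries {d : ℕ} (p : E d → ℂ) : MvPowerSeries (Fin d) ℂ :=
  fun I => (-Complex.I) ^ I.degree * multiDeriv I p 0 / ((∏ i, (I i).factorial : ℕ) : ℂ)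

/-- A polynomial in `ℝ[∂_1, …, ∂_d]` as a formal power series in `ℂ⟦∂_1, …, ∂_d⟧`. -/
def polySeries {d : ℕ} (q : MvPolynomial (Fin d) ℝ) : MvPowerSeries (Fin d) ℂ :=
  ((MvPolynomial.map (algebraMap ℝ ℂ) q : MvPolynomial (Fin d) ℂ) : MvPowerSeries (Fin d) ℂ)

/-- The functions on `ℝ^d` that extend analytically to some tube, with exponential decay there. -/
def C0 (d : ℕ) : Set (E d → ℂ) :=
  {f | ∃ ε > 0, ∃ δ > 0, ∃ F : EC d → ℂ,
    AnalyticOnNhd ℂ F (tube d ε) ∧ (∀ x, F (toComplex x) = f x) ∧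
    ∃ K : ℝ, ∀ z ∈ tube d ε, ‖F z‖ ≤ K * Real.exp (-(δ * ‖rePart z‖))}

/-- The function space `𝒞`: smooth functions all of whose derivatives lie in `C0`. -/
def funcSpace (d : ℕ) : Set (E d → ℂ) :=
  {f | ContDiff ℝ ∞ f ∧ ∀ I : Fin d →₀ ℕ, multiDeriv I f ∈ C0 d}

/-- The symbols that extend analytically to some tube, with subexponential growth there. -/
def P0 (d : ℕ) : Set (E d → ℂ) :=
  {p | ∃ ε > 0, ∃ F : EC d → ℂ,
    AnalyticOnNhd ℂ F (tube d ε) ∧ (∀ x, F (toComplex x) = p x) ∧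
    ∀ δ > 0, ∃ K > 0, ∀ z ∈ tube d ε, ‖F z‖ ≤ K * Real.exp (δ * ‖rePart z‖)}

/-- The pseudo-differential operators with symbol in `P0`, as formal power series in the `∂_j`. -/
def D0 (d : ℕ) : Set (MvPowerSeries (Fin d) ℂ) := symbolSeries '' P0 d

/-- The operators `𝒟`: finite sums `∑ p_k q_k` with `p_k ∈ D0` and `q_k ∈ ℝ[∂_1, …, ∂_d]`. -/
def opRing (d : ℕ) : Set (MvPowerSeries (Fin d) ℂ) :=
  {P | ∃ (n : ℕ) (p : Fin n → MvPowerSeries (Fin d) ℂ) (q : Fin n → MvPolynomial (Fin d) ℝ),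
    (∀ k, p k ∈ D0 d) ∧ P = ∑ k, p k * polySeries (q k)}

/-- A convenient analytical setting on `ℝ^d`: a space of smooth functions, a ring of
(pseudo-)differential operators `∑ c_I ∂_I ∈ ℂ⟦∂_1, …, ∂_d⟧` and the action of the operators on the
functions. -/
structure ConvenientAnalyticalSetting (d : ℕ) where
  /-- The function space; a complex vector space closed under pointwise products. -/
  funcs : NonUnitalSubalgebra ℂ (E d → ℂ)
  /-- The functions are smooth. -/
  smooth : ∀ f ∈ funcs, ContDiff ℝ ∞ f
  /-- The functions are integrable, so that they have a Fourier transform. -/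
  integrable : ∀ f ∈ funcs, Integrable f
  /-- The operators; they contain `1` and are closed under composition, which is the product of
  formal power series. -/
  ops : Subring (MvPowerSeries (Fin d) ℂ)
  /-- All real polynomial differential operators are among the operators. -/
  poly_mem : ∀ q : MvPolynomial (Fin d) ℝ, polySeries q ∈ ops
  /-- The operators map functions of the space to such functions, and composites of operators act
  successively. -/
  [module : Module ops funcs]
  /-- The operators are complex linear. -/
  linear : ∀ (P : ops) (c : ℂ) (f : funcs), P • (c • f) = c • (P • f)
  /-- Real polynomial differential operators act in the usual way. -/
  poly_act : ∀ (q : MvPolynomial (Fin d) ℝ) (f : funcs) (x : E d),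
    (((⟨polySeries q, poly_mem q⟩ : ops) • f : funcs) : E d → ℂ) x =
      ∑ I ∈ q.support, ((MvPolynomial.coeff I q : ℝ) : ℂ) * multiDeriv I (f : E d → ℂ) x
  /-- The operator `P = ∑ c_I ∂_I` maps `f` to `∑ c_I ∂_I f`, in the sense of pointwise convergence
  on some neighbourhood of the origin in Fourier space. -/
  act_hasSum : ∀ P : ops, ∃ U ∈ 𝓝 (0 : E d), ∀ f : funcs, ∀ ξ ∈ U,
    HasSum
      (fun I : Fin d →₀ ℕ =>
        MvPowerSeries.coeff I (P : MvPowerSeries (Fin d) ℂ) *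
          fourierT (multiDeriv I (f : E d → ℂ)) ξ)
      (fourierT ((P • f : funcs) : E d → ℂ) ξ)
  /-- The analytic Leibniz rule, in the sense of pointwise convergence on some neighbourhood of the
  origin in Fourier space; for every multi-index `J`, the finitely many terms with `I + I' = J` are
  grouped together. -/
  leibniz : ∀ P : ops, ∃ U ∈ 𝓝 (0 : E d), ∀ f g : funcs, ∀ ξ ∈ U,
    HasSum
      (fun J : Fin d →₀ ℕ => ∑ I ∈ Finset.HasAntidiagonal.antidiagonal J,
        (multiChoose (I.1 + I.2) I.1 : ℂ) *
          MvPowerSeries.coeff (I.1 + I.2) (P : MvPowerSeries (Fin d) ℂ) *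
            fourierT (multiDeriv I.1 (f : E d → ℂ) * multiDeriv I.2 (g : E d → ℂ)) ξ)
      (fourierT ((P • (f * g) : funcs) : E d → ℂ) ξ)
  /-- Convolution induces an isomorphism of modules over the ring of operators, from the tensor
  square of the function space to the function space. -/
  tensor : ∃ e : (funcs ⊗[ops] funcs) ≃ₗ[ops] funcs, ∀ f g : funcs,
    ConvolutionExists (f : E d → ℂ) (g : E d → ℂ) (ContinuousLinearMap.mul ℂ ℂ) volume ∧
    ((e (f ⊗ₜ[ops] g) : funcs) : E d → ℂ) =
      convolution (f : E d → ℂ) (g : E d → ℂ) (ContinuousLinearMap.mul ℂ ℂ) volume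
  /-- The function space is dense in all smooth functions, in the Fréchet topology: uniform
  convergence of all derivatives on compact sets. -/
  dense : ∀ g : E d → ℂ, ContDiff ℝ ∞ g → ∀ K : Set (E d), IsCompact K → ∀ (N : ℕ), ∀ η > 0,
    ∃ f ∈ funcs, ∀ I : Fin d →₀ ℕ, I.degree ≤ N → ∀ x ∈ K,
      ‖multiDeriv I f x - multiDeriv I g x‖ < η

attribute [instance] ConvenientAnalyticalSetting.module

end ConvAn

end

/-!
The Fourier transform maps `C0` bijectively onto itself. Exponential decay of `f` makes `f̂` extend
analytically to a tube; conversely, shifting the contour of the Fourier integral by `iy` within the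
tube of analyticity of `f` gains a factor `e^{⟨y, ξ⟩}`, which for `y` opposite to `ξ` is
exponential decay of `f̂`. In Fourier space everything is multiplicative: `C0` is an ideal of the
ring `P0` of symbols, `∂_j` is the symbol `iξ_j`, operators act as multiplication by their symbols
and convolution is the product. Near `0` a symbol is the sum of its Taylor series, so it is
determined by its formal power series, and multiplying that expansion by `f̂` gives the
expansion of `P f`; the Leibniz rule is this expansion applied to a product.

The function `∏ (cosh (a ξ_j))⁻¹` lies in `C0`, has no zeros, and for small `a` divides any given
element of `C0` with quotient in `C0`. Hence finitely many elements of `C0` have a common divisor,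
so every tensor is of the form `u ⊗ g` with `u` regular, and convolution is injective on the tensor
square. Multiplying `φ̂` by the same function and letting `a → 0` approximates a test function `φ`
by elements of `C0`, together with its derivatives.
-/

noncomputable section

namespace ConvAn

variable {d : ℕ}

section Geometry

@[simp] lemma rePart_apply (z : EC d) (i : Fin d) : rePart z i = (z i).re := rfl

@[simp] lemma imPart_apply (z : EC d) (i : Fin d) : imPart z i = (z i).im := rfl

@[simp] lemma toComplex_apply (x : E d) (i : Fin d) : toComplex x i = (x i : ℂ) := rfl

/-- The inclusion `ℝ^d ⊆ ℂ^d` as a continuous real linear map. -/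
def toComplexL (d : ℕ) : E d →L[ℝ] EC d :=
  LinearMap.toContinuousLinearMap
    { toFun := toComplex
      map_add' := fun x y => by ext i; simp
      map_smul' := fun c x => by ext i; simp }

/-- The real part `ℂ^d → ℝ^d` as a continuous real linear map. -/
def rePartL (d : ℕ) : EC d →L[ℝ] E d :=
  LinearMap.toContinuousLinearMap
    { toFun := rePart
      map_add' := fun x y => by ext i; simp
      map_smul' := fun c x => by ext i; simp }

/-- The imaginary part `ℂ^d → ℝ^d` as a continuous real linear map. -/
def imPartL (d : ℕ) : EC d →L[ℝ] E d :=
  LinearMap.toContinuousLinearMap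
    { toFun := imPart
      map_add' := fun x y => by ext i; simp
      map_smul' := fun c x => by ext i; simp }

lemma toComplex_add (x y : E d) : toComplex (x + y) = toComplex x + toComplex y :=
  (toComplexL d).map_add x y

@[simp] lemma toComplex_neg (x : E d) : toComplex (-x) = -toComplex x := (toComplexL d).map_neg x

lemma toComplex_smul (r : ℝ) (x : E d) : toComplex (r • x) = (r : ℂ) • toComplex x :=
  (toComplexL d).map_smul r x

lemma rePart_add (z w : EC d) : rePart (z + w) = rePart z + rePart w := (rePartL d).map_add z w

lemma imPart_add (z w : EC d) : imPart (z + w) = imPart z + imPart w := (imPartL d).map_add z w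

lemma rePart_neg (z : EC d) : rePart (-z) = -rePart z := (rePartL d).map_neg z

lemma imPart_neg (z : EC d) : imPart (-z) = -imPart z := (imPartL d).map_neg z

@[simp] lemma rePart_toComplex (x : E d) : rePart (toComplex x) = x := rfl

@[simp] lemma imPart_toComplex (x : E d) : imPart (toComplex x) = 0 := rfl

@[simp] lemma rePart_smul_toComplex (s : ℂ) (v : E d) : rePart (s • toComplex v) = s.re • v := by
  ext i; simp

@[simp] lemma imPart_smul_toComplex (s : ℂ) (v : E d) : imPart (s • toComplex v) = s.im • v := by
  ext i; simp

@[simp] lemma norm_toComplex (x : E d) : ‖toComplex x‖ = ‖x‖ := by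
  simp [EuclideanSpace.norm_eq]

lemma norm_apply_le_rePart_add_imPart (z : EC d) (i : Fin d) :
    ‖z i‖ ≤ ‖rePart z‖ + ‖imPart z‖ := by
  refine (Complex.norm_le_abs_re_add_abs_im (z i)).trans (add_le_add ?_ ?_)
  · simpa using PiLp.norm_apply_le (rePart z) i
  · simpa using PiLp.norm_apply_le (imPart z) i

lemma tube_mono {ε ε' : ℝ} (h : ε ≤ ε') : tube d ε ⊆ tube d ε' :=
  fun _ hz => lt_of_lt_of_le hz h

lemma toComplex_mem_tube {ε : ℝ} (hε : 0 < ε) (x : E d) : toComplex x ∈ tube d ε := by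
  simpa [tube] using hε

lemma toComplex_add_mem_tube {ε : ℝ} {x : E d} {w : EC d} :
    toComplex x + w ∈ tube d ε ↔ w ∈ tube d ε := by
  simp [tube, imPart_add]

lemma neg_mem_tube {ε : ℝ} {z : EC d} : -z ∈ tube d ε ↔ z ∈ tube d ε := by
  simp [tube, imPart_neg]

lemma tube_eq_preimage_ball (ε : ℝ) : tube d ε = imPartL d ⁻¹' Metric.ball 0 ε := by
  ext z
  exact mem_ball_zero_iff.symm

lemma isOpen_tube (ε : ℝ) : IsOpen (tube d ε) := by
  rw [tube_eq_preimage_ball]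
  exact Metric.isOpen_ball.preimage (imPartL d).continuous

lemma convex_tube (ε : ℝ) : Convex ℝ (tube d ε) := by
  rw [tube_eq_preimage_ball]
  exact (convex_ball 0 ε).linear_preimage (imPartL d).toLinearMap

end Geometry

section ExponentialDecay

lemma exp_neg_mul_le_one_add_rpow (n : ℕ) {δ t : ℝ} (hδ : 0 < δ) (ht : 0 ≤ t) :
    Real.exp (-(δ * t)) ≤ Real.exp δ * n.factorial / δ ^ n * (1 + t) ^ (-(n : ℝ)) := by
  have h := Real.pow_div_factorial_le_exp (δ * (1 + t)) (by positivity) n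
  rw [div_le_iff₀ (by positivity), mul_pow, mul_one_add, Real.exp_add] at h
  rw [Real.rpow_neg (by positivity), Real.rpow_natCast, Real.exp_neg, ← div_eq_mul_inv,
    div_div, le_div_iff₀ (by positivity), ← div_eq_inv_mul, div_le_iff₀ (Real.exp_pos _)]
  linarith

lemma integrable_exp_neg_mul_norm {V : Type*} [NormedAddCommGroup V] [NormedSpace ℝ V]
    [FiniteDimensional ℝ V] [MeasurableSpace V] [BorelSpace V] (μ : Measure V)
    [μ.IsAddHaarMeasure] {δ : ℝ} (hδ : 0 < δ) :
    Integrable (fun x => Real.exp (-(δ * ‖x‖))) μ := by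
  have hdim : (Module.finrank ℝ V : ℝ) < (Module.finrank ℝ V + 1 : ℕ) := by simp
  refine ((integrable_one_add_norm hdim).const_mul
    (Real.exp δ * (Module.finrank ℝ V + 1).factorial / δ ^ (Module.finrank ℝ V + 1))).mono'
    (by fun_prop) (Filter.Eventually.of_forall fun x => ?_)
  rw [Real.norm_of_nonneg (Real.exp_pos _).le]
  exact exp_neg_mul_le_one_add_rpow _ hδ (norm_nonneg x)

end ExponentialDecay

section TubeGrowth

/-- The condition common to `C0` and `P0`: `F` is analytic on the tube of width `ε`, where it is
bounded by a multiple of `e^{a‖x‖}`. The rate `a` may have either sign. -/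
structure TubeGrowth (ε a : ℝ) (F : EC d → ℂ) : Prop where
  analyticOnNhd : AnalyticOnNhd ℂ F (tube d ε)
  exists_bound : ∃ K ≥ 0, ∀ z ∈ tube d ε, ‖F z‖ ≤ K * Real.exp (a * ‖rePart z‖)

variable {ε ε' a b : ℝ} {F G : EC d → ℂ}

lemma TubeGrowth.mono (hF : TubeGrowth ε a F) (hε : ε' ≤ ε) (ha : a ≤ b) :
    TubeGrowth ε' b F := by
  obtain ⟨K, hK, hFK⟩ := hF.exists_bound
  refine ⟨hF.analyticOnNhd.mono (tube_mono hε), K, hK, fun z hz => ?_⟩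
  exact (hFK z (tube_mono hε hz)).trans (by gcongr)

lemma TubeGrowth.add (hF : TubeGrowth ε a F) (hG : TubeGrowth ε a G) :
    TubeGrowth ε a (F + G) := by
  obtain ⟨K, hK, hFK⟩ := hF.exists_bound
  obtain ⟨L, hL, hGL⟩ := hG.exists_bound
  refine ⟨hF.analyticOnNhd.add hG.analyticOnNhd, K + L, add_nonneg hK hL, fun z hz => ?_⟩
  rw [add_mul]
  exact norm_add_le_of_le (hFK z hz) (hGL z hz)

lemma TubeGrowth.mul (hF : TubeGrowth ε a F) (hG : TubeGrowth ε b G) :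
    TubeGrowth ε (a + b) (F * G) := by
  obtain ⟨K, hK, hFK⟩ := hF.exists_bound
  obtain ⟨L, hL, hGL⟩ := hG.exists_bound
  refine ⟨hF.analyticOnNhd.mul hG.analyticOnNhd, K * L, mul_nonneg hK hL, fun z hz => ?_⟩
  calc ‖(F * G) z‖ ≤ ‖F z‖ * ‖G z‖ := norm_mul_le _ _
    _ ≤ (K * Real.exp (a * ‖rePart z‖)) * (L * Real.exp (b * ‖rePart z‖)) :=
        mul_le_mul (hFK z hz) (hGL z hz) (norm_nonneg _) (by positivity)
    _ = K * L * Real.exp ((a + b) * ‖rePart z‖) := by rw [add_mul, Real.exp_add]; ring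

lemma TubeGrowth.comp_neg (hF : TubeGrowth ε a F) : TubeGrowth ε a (fun z => F (-z)) := by
  obtain ⟨K, hK, hFK⟩ := hF.exists_bound
  refine ⟨fun z hz => ?_, K, hK, fun z hz => ?_⟩
  · exact (hF.analyticOnNhd _ (neg_mem_tube.2 hz)).comp_of_eq analyticAt_id.neg rfl
  · simpa [rePart_neg] using hFK (-z) (neg_mem_tube.2 hz)

lemma tubeGrowth_const (ha : 0 ≤ a) (c : ℂ) : TubeGrowth ε a (fun _ : EC d => c) := by
  refine ⟨analyticOnNhd_const, ‖c‖, norm_nonneg c, fun z _ => ?_⟩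
  exact le_mul_of_one_le_right (norm_nonneg c) (Real.one_le_exp (by positivity))

lemma tubeGrowth_apply (hε : 0 ≤ ε) (ha : 0 < a) (i : Fin d) :
    TubeGrowth ε a (fun z : EC d => z i) := by
  refine ⟨fun z _ => (EuclideanSpace.proj (𝕜 := ℂ) i).analyticAt z, 1 / a + ε, by positivity,
    fun z hz => ?_⟩
  have hre : ‖rePart z‖ ≤ 1 / a * Real.exp (a * ‖rePart z‖) := by
    rw [div_mul_eq_mul_div, le_div_iff₀ ha]
    linarith [Real.add_one_le_exp (a * ‖rePart z‖)]
  have him : ‖imPart z‖ ≤ ε * Real.exp (a * ‖rePart z‖) :=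
    hz.le.trans (le_mul_of_one_le_right hε (Real.one_le_exp (by positivity)))
  linarith [norm_apply_le_rePart_add_imPart z i]

end TubeGrowth

section Classes

variable {f g : E d → ℂ}

lemma mem_C0_iff : f ∈ C0 d ↔
    ∃ ε > 0, ∃ δ > 0, ∃ F, TubeGrowth ε (-δ) F ∧ F ∘ toComplex = f := by
  constructor
  · rintro ⟨ε, hε, δ, hδ, F, hF, hFf, K, hK⟩
    refine ⟨ε, hε, δ, hδ, F, ⟨hF, |K|, abs_nonneg K, fun z hz => ?_⟩, funext hFf⟩
    rw [neg_mul]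
    exact (hK z hz).trans (by gcongr; exact le_abs_self K)
  · rintro ⟨ε, hε, δ, hδ, F, ⟨hF, K, -, hK⟩, hFf⟩
    exact ⟨ε, hε, δ, hδ, F, hF, congrFun hFf, K, fun z hz => by simpa using hK z hz⟩

lemma mem_P0_iff : f ∈ P0 d ↔
    ∃ ε > 0, ∃ F, (∀ δ > 0, TubeGrowth ε δ F) ∧ F ∘ toComplex = f := by
  constructor
  · rintro ⟨ε, hε, F, hF, hFf, hbound⟩
    refine ⟨ε, hε, F, fun δ hδ => ⟨hF, ?_⟩, funext hFf⟩
    obtain ⟨K, hK, hFK⟩ := hbound δ hδ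
    exact ⟨K, hK.le, hFK⟩
  · rintro ⟨ε, hε, F, hF, hFf⟩
    refine ⟨ε, hε, F, (hF 1 one_pos).analyticOnNhd, congrFun hFf, fun δ hδ => ?_⟩
    obtain ⟨K, hK, hFK⟩ := (hF δ hδ).exists_bound
    exact ⟨K + 1, by positivity, fun z hz => (hFK z hz).trans (by gcongr; linarith)⟩

lemma C0_subset_P0 : C0 d ⊆ P0 d := fun _ hf => by
  obtain ⟨ε, hε, δ, hδ, F, hF, hFf⟩ := mem_C0_iff.1 hf
  exact mem_P0_iff.2 ⟨ε, hε, F, fun δ' hδ' => hF.mono le_rfl (by linarith), hFf⟩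

lemma analyticOnNhd_of_mem_P0 (hf : f ∈ P0 d) : AnalyticOnNhd ℝ f Set.univ := by
  obtain ⟨ε, hε, F, hF, rfl⟩ := mem_P0_iff.1 hf
  intro x _
  have hFx : AnalyticAt ℝ F (toComplexL d x) :=
    ((hF 1 one_pos).analyticOnNhd _ (toComplex_mem_tube hε x)).restrictScalars
  exact hFx.comp ((toComplexL d).analyticAt x)

lemma contDiff_of_mem_P0 (hf : f ∈ P0 d) : ContDiff ℝ ∞ f :=
  (analyticOnNhd_of_mem_P0 hf).contDiff

lemma contDiff_of_mem_C0 (hf : f ∈ C0 d) : ContDiff ℝ ∞ f := contDiff_of_mem_P0 (C0_subset_P0 hf)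

lemma continuous_of_mem_C0 (hf : f ∈ C0 d) : Continuous f := (contDiff_of_mem_C0 hf).continuous

lemma exists_bound_of_mem_C0 (hf : f ∈ C0 d) :
    ∃ δ > 0, ∃ K : ℝ, ∀ x, ‖f x‖ ≤ K * Real.exp (-(δ * ‖x‖)) := by
  obtain ⟨ε, hε, δ, hδ, F, -, hFf, K, hK⟩ := hf
  exact ⟨δ, hδ, K, fun x => by simpa [hFf] using hK _ (toComplex_mem_tube hε x)⟩

lemma integrable_of_mem_C0 (hf : f ∈ C0 d) : Integrable f := by
  obtain ⟨δ, hδ, K, hK⟩ := exists_bound_of_mem_C0 hf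
  exact ((integrable_exp_neg_mul_norm volume hδ).const_mul K).mono'
    (continuous_of_mem_C0 hf).aestronglyMeasurable (Filter.Eventually.of_forall hK)

lemma add_mem_P0 (hf : f ∈ P0 d) (hg : g ∈ P0 d) : f + g ∈ P0 d := by
  obtain ⟨ε, hε, F, hF, rfl⟩ := mem_P0_iff.1 hf
  obtain ⟨η, hη, G, hG, rfl⟩ := mem_P0_iff.1 hg
  exact mem_P0_iff.2 ⟨min ε η, lt_min hε hη, F + G, fun δ hδ =>
    ((hF δ hδ).mono (min_le_left _ _) le_rfl).add ((hG δ hδ).mono (min_le_right _ _) le_rfl), rfl⟩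

lemma mul_mem_P0 (hf : f ∈ P0 d) (hg : g ∈ P0 d) : f * g ∈ P0 d := by
  obtain ⟨ε, hε, F, hF, rfl⟩ := mem_P0_iff.1 hf
  obtain ⟨η, hη, G, hG, rfl⟩ := mem_P0_iff.1 hg
  refine mem_P0_iff.2 ⟨min ε η, lt_min hε hη, F * G, fun δ hδ => ?_, rfl⟩
  rw [← add_halves δ]
  exact ((hF _ (half_pos hδ)).mono (min_le_left _ _) le_rfl).mul
    ((hG _ (half_pos hδ)).mono (min_le_right _ _) le_rfl)

lemma const_mem_P0 (c : ℂ) : (fun _ : E d => c) ∈ P0 d :=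
  mem_P0_iff.2 ⟨1, one_pos, fun _ => c, fun _ hδ => tubeGrowth_const hδ.le c, rfl⟩

lemma coord_mem_P0 (i : Fin d) : (fun x : E d => (x i : ℂ)) ∈ P0 d :=
  mem_P0_iff.2 ⟨1, one_pos, fun z => z i, fun _ hδ => tubeGrowth_apply zero_le_one hδ i, rfl⟩

lemma zero_mem_C0 : (0 : E d → ℂ) ∈ C0 d :=
  ⟨1, one_pos, 1, one_pos, 0, analyticOnNhd_const, fun _ => rfl, 0, fun z _ => by simp⟩

lemma add_mem_C0 (hf : f ∈ C0 d) (hg : g ∈ C0 d) : f + g ∈ C0 d := by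
  obtain ⟨ε, hε, δ, hδ, F, hF, rfl⟩ := mem_C0_iff.1 hf
  obtain ⟨η, hη, δ', hδ', G, hG, rfl⟩ := mem_C0_iff.1 hg
  exact mem_C0_iff.2 ⟨min ε η, lt_min hε hη, min δ δ', lt_min hδ hδ', F + G,
    (hF.mono (min_le_left _ _) (neg_le_neg (min_le_left _ _))).add
      (hG.mono (min_le_right _ _) (neg_le_neg (min_le_right _ _))), rfl⟩

lemma mul_mem_C0 (hf : f ∈ P0 d) (hg : g ∈ C0 d) : f * g ∈ C0 d := by
  obtain ⟨ε, hε, F, hF, rfl⟩ := mem_P0_iff.1 hf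
  obtain ⟨η, hη, δ, hδ, G, hG, rfl⟩ := mem_C0_iff.1 hg
  refine mem_C0_iff.2 ⟨min ε η, lt_min hε hη, δ / 2, half_pos hδ, F * G, ?_, rfl⟩
  rw [show -(δ / 2) = δ / 2 + -δ by ring]
  exact ((hF _ (half_pos hδ)).mono (min_le_left _ _) le_rfl).mul (hG.mono (min_le_right _ _) le_rfl)

lemma smul_mem_C0 (c : ℂ) (hf : f ∈ C0 d) : c • f ∈ C0 d := mul_mem_C0 (const_mem_P0 c) hf

lemma comp_neg_mem_C0 (hf : f ∈ C0 d) : (fun x => f (-x)) ∈ C0 d := by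
  obtain ⟨ε, hε, δ, hδ, F, hF, rfl⟩ := mem_C0_iff.1 hf
  exact mem_C0_iff.2 ⟨ε, hε, δ, hδ, _, hF.comp_neg, funext fun x => by simp⟩

end Classes

section ParametricPowerSeries

variable {X V W : Type*} [MeasurableSpace X] {μ : Measure X} [NormedAddCommGroup V]
  [NormedSpace ℂ V] [NormedAddCommGroup W] [NormedSpace ℂ W]

lemma hasFPowerSeriesOnBall_integral {f : X → V → W} {p : X → FormalMultilinearSeries ℂ V W}
    {z : V} {r : NNReal} (hr : 0 < r) {B : ℕ → X → ℝ} {b : X → ℝ}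
    (hf : ∀ x, HasFPowerSeriesOnBall (f x) (p x) z r)
    (hp : ∀ n, AEStronglyMeasurable (fun x => p x n) μ)
    (hpB : ∀ n x, ‖p x n‖ * (r : ℝ) ^ n ≤ B n x) (hB : ∀ x, HasSum (fun n => B n x) (b x))
    (hb : Integrable b μ) :
    HasFPowerSeriesOnBall (fun w => ∫ x, f x w ∂μ) (fun n => ∫ x, p x n ∂μ) z r := by
  have hpb (n : ℕ) (x : X) : ‖p x n‖ * (r : ℝ) ^ n ≤ b x :=
    (hpB n x).trans (le_hasSum (hB x) n fun m _ => le_trans (by positivity) (hpB m x))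
  have hint (n : ℕ) : Integrable (fun x => p x n) μ := by
    refine (hb.div_const ((r : ℝ) ^ n)).mono' (hp n) (Filter.Eventually.of_forall fun x => ?_)
    rw [le_div_iff₀ (by positivity)]
    exact hpb n x
  refine ⟨?_, by simpa using hr, fun {y} hy => ?_⟩
  · refine FormalMultilinearSeries.le_radius_of_bound _ (∫ x, b x ∂μ) fun n => ?_
    calc ‖∫ x, p x n ∂μ‖ * (r : ℝ) ^ n ≤ (∫ x, ‖p x n‖ ∂μ) * (r : ℝ) ^ n := by
          gcongr; exact norm_integral_le_integral_norm _
      _ = ∫ x, ‖p x n‖ * (r : ℝ) ^ n ∂μ := (integral_mul_const _ _).symm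
      _ ≤ ∫ x, b x ∂μ := integral_mono ((hint n).norm.mul_const _) hb (hpb n)
  · have hyr : ‖y‖ ≤ r := by
      simpa [← NNReal.coe_le_coe] using (Metric.mem_eball.1 hy).le
    simp only [ContinuousMultilinearMap.integral_apply (hint _)]
    refine hasSum_integral_of_dominated_convergence B
      (fun n => (ContinuousMultilinearMap.apply ℂ (fun _ : Fin n => V) W
        fun _ => y).continuous.comp_aestronglyMeasurable (hp n))
      (fun n => Filter.Eventually.of_forall fun x => ?_)
      (Filter.Eventually.of_forall fun x => (hB x).summable)
      (hb.congr (Filter.Eventually.of_forall fun x => (hB x).tsum_eq.symm))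
      (Filter.Eventually.of_forall fun x => (hf x).hasSum hy)
    refine ((p x n).le_opNorm _).trans (le_trans ?_ (hpB n x))
    simp only [Finset.prod_const, Finset.card_univ, Fintype.card_fin]
    gcongr

/-- The power series of `ζ ↦ e^{l ζ}` at the origin, for a linear form `l`. -/
def expFormSeries (l : V →L[ℂ] ℂ) : FormalMultilinearSeries ℂ V ℂ :=
  (NormedSpace.expSeries ℂ ℂ).compContinuousLinearMap l

lemma hasFPowerSeriesOnBall_exp_form (l : V →L[ℂ] ℂ) :
    HasFPowerSeriesOnBall (fun ζ => Complex.exp (l ζ)) (expFormSeries l) 0 ⊤ := by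
  have hexp : HasFPowerSeriesOnBall Complex.exp (NormedSpace.expSeries ℂ ℂ) (l 0) ⊤ := by
    rw [map_zero, Complex.exp_eq_exp_ℂ]
    exact NormedSpace.exp_hasFPowerSeriesOnBall
  simpa [ENNReal.top_div] using! hexp.compContinuousLinearMap

lemma norm_expFormSeries_le (l : V →L[ℂ] ℂ) (n : ℕ) :
    ‖expFormSeries l n‖ ≤ ‖l‖ ^ n / n.factorial := by
  refine (ContinuousMultilinearMap.norm_compContinuousLinearMap_le _ _).trans ?_
  simp [NormedSpace.expSeries, norm_smul, div_eq_inv_mul]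

lemma continuous_expFormSeries (n : ℕ) :
    Continuous (fun l : V →L[ℂ] ℂ => expFormSeries l n) :=
  ((ContinuousMultilinearMap.compContinuousLinearMapContinuousMultilinear ℂ
    (fun _ : Fin n => V) (fun _ => ℂ) ℂ).cont.comp
      (continuous_pi fun _ => continuous_id)).clm_apply continuous_const

lemma hasFPowerSeriesOnBall_integral_exp {c : X → ℂ} {L : X → V →L[ℂ] ℂ} {r : NNReal}
    (hr : 0 < r) (hc : AEStronglyMeasurable c μ) (hL : AEStronglyMeasurable L μ)
    (hint : Integrable (fun x => Real.exp (r * ‖L x‖) * ‖c x‖) μ) :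
    HasFPowerSeriesOnBall (fun ζ => ∫ x, c x • Complex.exp (L x ζ) ∂μ)
      (fun n => ∫ x, c x • expFormSeries (L x) n ∂μ) 0 r := by
  refine hasFPowerSeriesOnBall_integral (f := fun x => c x • fun ζ => Complex.exp (L x ζ))
    (p := fun x => c x • expFormSeries (L x)) hr
    (B := fun n x => (r * ‖L x‖) ^ n / n.factorial * ‖c x‖)
    (fun x => (hasFPowerSeriesOnBall_exp_form (L x)).const_smul.mono (ENNReal.coe_pos.2 hr) le_top)
    (fun n => hc.smul ((continuous_expFormSeries n).comp_aestronglyMeasurable hL))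
    (fun n x => ?_) (fun x => ?_) hint
  · rw [mul_pow]
    calc ‖c x • expFormSeries (L x) n‖ * (r : ℝ) ^ n
        = ‖c x‖ * ‖expFormSeries (L x) n‖ * (r : ℝ) ^ n := by rw [norm_smul]
      _ ≤ ‖c x‖ * (‖L x‖ ^ n / n.factorial) * (r : ℝ) ^ n := by
          gcongr; exact norm_expFormSeries_le _ n
      _ = (r : ℝ) ^ n * ‖L x‖ ^ n / n.factorial * ‖c x‖ := by ring
  · rw [Real.exp_eq_exp_ℝ]
    exact (NormedSpace.expSeries_div_hasSum_exp (r * ‖L x‖)).mul_right _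

end ParametricPowerSeries

section HolomorphicParameter

variable {X W : Type*} [MeasurableSpace X] {μ : Measure X} [NormedAddCommGroup W] [NormedSpace ℂ W]

lemma aestronglyMeasurable_deriv_param {f : ℂ → X → W} {s₀ : ℂ} {R : ℝ} (hR : 0 < R)
    (hmeas : ∀ s ∈ Metric.ball s₀ R, AEStronglyMeasurable (f s) μ)
    (hdiff : ∀ x, DifferentiableAt ℂ (fun s => f s x) s₀) :
    AEStronglyMeasurable (fun x => deriv (fun s => f s x) s₀) μ := by
  classical
  have hball : ∀ᶠ t in 𝓝[≠] (0 : ℂ), s₀ + t ∈ Metric.ball s₀ R := by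
    filter_upwards [nhdsWithin_le_nhds (Metric.ball_mem_nhds (0 : ℂ) hR)] with t ht
    simpa using ht
  refine aestronglyMeasurable_of_tendsto_ae (𝓝[≠] (0 : ℂ))
    (f := fun t x => if s₀ + t ∈ Metric.ball s₀ R then t⁻¹ • (f (s₀ + t) x - f s₀ x) else 0)
    (fun t => ?_) (Filter.Eventually.of_forall fun x => ?_)
  · split_ifs with ht
    · exact ((hmeas _ ht).sub (hmeas _ (Metric.mem_ball_self hR))).const_smul _
    · exact aestronglyMeasurable_const
  · refine (hdiff x).hasDerivAt.tendsto_slope_zero.congr' ?_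
    filter_upwards [hball] with t ht
    rw [if_pos ht]

lemma differentiableAt_integral_of_dominated {f : ℂ → X → W} {s₀ : ℂ} {R : ℝ} {b : X → ℝ}
    (hR : 0 < R) (hmeas : ∀ s ∈ Metric.ball s₀ R, AEStronglyMeasurable (f s) μ)
    (hdiff : ∀ x, DifferentiableOn ℂ (fun s => f s x) (Metric.ball s₀ R))
    (hbound : ∀ s ∈ Metric.ball s₀ R, ∀ x, ‖f s x‖ ≤ b x) (hb : Integrable b μ) :
    DifferentiableAt ℂ (fun s => ∫ x, f s x ∂μ) s₀ := by
  have hdiffAt (x : X) {s : ℂ} (hs : s ∈ Metric.ball s₀ R) :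
      DifferentiableAt ℂ (fun s => f s x) s :=
    (hdiff x).differentiableAt (Metric.isOpen_ball.mem_nhds hs)
  have hs₀ : s₀ ∈ Metric.ball s₀ R := Metric.mem_ball_self hR
  have hsub {s : ℂ} (hs : s ∈ Metric.ball s₀ (R / 2)) :
      Metric.closedBall s (R / 3) ⊆ Metric.ball s₀ R :=
    Metric.closedBall_subset_ball' (by linarith [Metric.mem_ball.1 hs])
  have hderiv_le : ∀ x, ∀ s ∈ Metric.ball s₀ (R / 2),
      ‖deriv (fun s => f s x) s‖ ≤ b x / (R / 3) := fun x s hs =>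
    Complex.norm_deriv_le_of_forall_mem_sphere_norm_le (by positivity)
      (((hdiff x).mono (hsub hs)).diffContOnCl_ball subset_rfl)
      fun z hz => hbound z (hsub hs (Metric.sphere_subset_closedBall hz)) x
  refine (hasDerivAt_integral_of_dominated_loc_of_deriv_le
    (F' := fun s x => deriv (fun s => f s x) s) (Metric.ball_mem_nhds s₀ (half_pos hR)) ?_
    (hb.mono' (hmeas s₀ hs₀) (Filter.Eventually.of_forall (hbound s₀ hs₀)))
    (aestronglyMeasurable_deriv_param hR hmeas fun x => hdiffAt x hs₀)
    (Filter.Eventually.of_forall hderiv_le) (hb.div_const _)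
    (Filter.Eventually.of_forall fun x s hs => (hdiffAt x
      (Metric.ball_subset_ball (half_le_self hR.le) hs)).hasDerivAt)).2.differentiableAt
  filter_upwards [Metric.ball_mem_nhds s₀ hR] with s hs using hmeas s hs

lemma eq_of_forall_add_ofReal_eq {J : ℂ → W} {S : Set ℂ} (hS : IsOpen S) (hS' : IsPreconnected S)
    (hJ : DifferentiableOn ℂ J S) (htrans : ∀ (s : ℂ) (r : ℝ), J (s + r) = J s) {s t : ℂ}
    (hs : s ∈ S) (ht : t ∈ S) : J s = J t := by
  refine hS.is_const_of_deriv_eq_zero hS' hJ (fun u hu => ?_) hs ht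
  have hderiv : HasDerivAt J (deriv J u) u := (hJ.differentiableAt (hS.mem_nhds hu)).hasDerivAt
  have hline : HasDerivAt (fun r : ℝ => u + (r : ℂ)) 1 0 :=
    ((hasDerivAt_id (0 : ℝ)).ofReal_comp).const_add u
  have hreal : HasDerivAt (fun r : ℝ => J (u + r)) ((1 : ℂ) • deriv J u) 0 :=
    HasDerivAt.scomp (g₁ := J) 0 (by rwa [Complex.ofReal_zero, add_zero]) hline
  rw [one_smul] at hreal
  simp only [htrans] at hreal
  exact hreal.unique (hasDerivAt_const _ _)

end HolomorphicParameter

section ContourShift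

variable {ε η a δ : ℝ} {F : EC d → ℂ} {v : E d}

lemma exp_mul_norm_add_le {V : Type*} [SeminormedAddCommGroup V] (a : ℝ) (x y : V) :
    Real.exp (a * ‖x + y‖) ≤ Real.exp (|a| * ‖y‖) * Real.exp (a * ‖x‖) := by
  rw [← Real.exp_add, Real.exp_le_exp]
  have h : a * (‖x + y‖ - ‖x‖) ≤ |a| * ‖y‖ := by
    refine (le_abs_self _).trans ?_
    rw [abs_mul]
    gcongr
    simpa using abs_norm_sub_norm_le (x + y) x
  linarith

lemma TubeGrowth.exists_bound_add (hF : TubeGrowth ε a F) (R : ℝ) :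
    ∃ K ≥ 0, ∀ z w : EC d, z + w ∈ tube d ε → ‖rePart w‖ ≤ R →
      ‖F (z + w)‖ ≤ K * Real.exp (a * ‖rePart z‖) := by
  obtain ⟨K, hK, hFK⟩ := hF.exists_bound
  refine ⟨K * Real.exp (|a| * R), by positivity, fun z w hzw hw => (hFK _ hzw).trans ?_⟩
  rw [rePart_add, mul_assoc]
  gcongr
  exact (exp_mul_norm_add_le a _ _).trans (by gcongr)

lemma norm_rePart_smul_toComplex_le (s : ℂ) (v : E d) :
    ‖rePart (s • toComplex v)‖ ≤ ‖s‖ * ‖v‖ := by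
  rw [rePart_smul_toComplex, norm_smul]
  gcongr
  exact Complex.abs_re_le_norm s

lemma norm_imPart_smul_toComplex_le (s : ℂ) (v : E d) :
    ‖imPart (s • toComplex v)‖ ≤ ‖s‖ * ‖v‖ := by
  rw [imPart_smul_toComplex, norm_smul]
  gcongr
  exact Complex.abs_im_le_norm s

lemma isOpen_setOf_smul_mem_tube (ε : ℝ) (v : E d) :
    IsOpen {s : ℂ | s • toComplex v ∈ tube d ε} :=
  (isOpen_tube ε).preimage (by fun_prop)

lemma convex_setOf_smul_mem_tube (ε : ℝ) (v : E d) :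
    Convex ℝ {s : ℂ | s • toComplex v ∈ tube d ε} :=
  (convex_tube ε).linear_preimage
    ((LinearMap.toSpanSingleton ℂ (EC d) (toComplex v)).restrictScalars ℝ)

lemma TubeGrowth.differentiableOn_integral_add_smul (hF : TubeGrowth ε (-δ) F) (hδ : 0 < δ)
    (v : E d) :
    DifferentiableOn ℂ (fun s : ℂ => ∫ x : E d, F (toComplex x + s • toComplex v))
      {s | s • toComplex v ∈ tube d ε} := by
  intro s₀ hs₀
  obtain ⟨R, hR, hsub⟩ := Metric.isOpen_iff.1 (isOpen_setOf_smul_mem_tube ε v) s₀ hs₀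
  obtain ⟨K, -, hFK⟩ := hF.exists_bound_add ((‖s₀‖ + R) * ‖v‖)
  have hmem (s : ℂ) (hs : s ∈ Metric.ball s₀ R) (x : E d) :
      toComplex x + s • toComplex v ∈ tube d ε := toComplex_add_mem_tube.2 (hsub hs)
  refine (differentiableAt_integral_of_dominated
    (b := fun x => K * Real.exp (-(δ * ‖x‖))) hR (fun s hs => ?_) (fun x s hs => ?_)
    (fun s hs x => ?_)
    ((integrable_exp_neg_mul_norm volume hδ).const_mul K)).differentiableWithinAt
  · exact (hF.analyticOnNhd.continuousOn.comp_continuous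
      ((toComplexL d).continuous.add continuous_const) (hmem s hs)).aestronglyMeasurable
  · have hline : DifferentiableAt ℂ (fun s : ℂ => toComplex x + s • toComplex v) s := by fun_prop
    exact ((hF.analyticOnNhd _ (hmem s hs x)).differentiableAt.comp s hline).differentiableWithinAt
  · have hs' : ‖s‖ ≤ ‖s₀‖ + R := by
      linarith [norm_le_norm_add_norm_sub' s s₀, mem_ball_iff_norm.1 hs]
    simpa using hFK _ _ (hmem s hs x) ((norm_rePart_smul_toComplex_le s v).trans (by gcongr))

lemma TubeGrowth.integral_add_I_smul (hF : TubeGrowth ε (-δ) F) (hδ : 0 < δ) (hv : ‖v‖ < ε) :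
    ∫ x : E d, F (toComplex x + Complex.I • toComplex v) = ∫ x : E d, F (toComplex x) := by
  have htrans (s : ℂ) (r : ℝ) : ∫ x : E d, F (toComplex x + (s + r) • toComplex v)
      = ∫ x : E d, F (toComplex x + s • toComplex v) := by
    rw [← integral_add_right_eq_self (fun x : E d => F (toComplex x + s • toComplex v)) (r • v)]
    simp only [toComplex_add, toComplex_smul, add_smul, add_left_comm, add_comm]
  have h0 : (0 : ℂ) • toComplex v ∈ tube d ε := by
    change ‖imPart _‖ < ε
    rw [imPart_smul_toComplex, Complex.zero_im, zero_smul, norm_zero]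
    exact (norm_nonneg v).trans_lt hv
  have hI : Complex.I • toComplex v ∈ tube d ε := by simpa [tube] using hv
  simpa using eq_of_forall_add_ofReal_eq (isOpen_setOf_smul_mem_tube ε v)
    (convex_setOf_smul_mem_tube ε v).isPreconnected
    (hF.differentiableOn_integral_add_smul hδ v) htrans hI h0

end ContourShift

section CauchyEstimate

variable {ε ε' a : ℝ} {F : EC d → ℂ} {f : E d → ℂ}

lemma TubeGrowth.fderiv_toComplex (hF : TubeGrowth ε a F) (hε : ε' < ε) (v : E d) :
    TubeGrowth ε' a (fun z => fderiv ℂ F z (toComplex v)) := by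
  obtain ⟨R, hR, hRv⟩ : ∃ R > 0, R * ‖v‖ < ε - ε' := by
    simpa only [mul_comm] using exists_pos_mul_lt (sub_pos.2 hε) ‖v‖
  obtain ⟨K, hK, hFK⟩ := hF.exists_bound_add (R * ‖v‖)
  refine ⟨fun z hz => ?_, K / R, by positivity, fun z hz => ?_⟩
  · exact ((ContinuousLinearMap.apply ℂ ℂ (toComplex v)).analyticAt _).comp
      ((hF.analyticOnNhd z (tube_mono hε.le hz)).fderiv)
  have hmem {s : ℂ} (hs : ‖s‖ ≤ R) : z + s • toComplex v ∈ tube d ε := by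
    have him := norm_imPart_smul_toComplex_le s v
    have hz' : ‖imPart z‖ < ε' := hz
    change ‖imPart (z + s • toComplex v)‖ < ε
    rw [imPart_add]
    nlinarith [norm_add_le (imPart z) (imPart (s • toComplex v)), norm_nonneg v]
  have hderiv {s : ℂ} (hs : ‖s‖ ≤ R) : HasDerivAt (fun s : ℂ => F (z + s • toComplex v))
      (fderiv ℂ F (z + s • toComplex v) (toComplex v)) s := by
    have hline : HasDerivAt (fun s : ℂ => z + s • toComplex v) (toComplex v) s := by
      simpa using ((hasDerivAt_id s).smul_const (toComplex v)).const_add z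
    exact (hF.analyticOnNhd _ (hmem hs)).differentiableAt.hasFDerivAt.comp_hasDerivAt s hline
  have hderiv0 := (hderiv (s := 0) (by simpa using hR.le)).deriv
  rw [zero_smul, add_zero] at hderiv0
  rw [← hderiv0, div_mul_eq_mul_div]
  refine Complex.norm_deriv_le_of_forall_mem_sphere_norm_le hR ?_ fun s hs => ?_
  · refine DifferentiableOn.diffContOnCl_ball (U := Metric.closedBall 0 R) (fun s hs => ?_)
      subset_rfl
    exact (hderiv (by simpa using hs)).differentiableAt.differentiableWithinAt
  · have hs' : ‖s‖ = R := by simpa using hs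
    exact hFK _ _ (hmem hs'.le) ((norm_rePart_smul_toComplex_le s v).trans (by rw [hs']))

theorem partialDeriv_mem_C0 (j : Fin d) (hf : f ∈ C0 d) : partialDeriv j f ∈ C0 d := by
  obtain ⟨ε, hε, δ, hδ, F, hF, rfl⟩ := mem_C0_iff.1 hf
  refine mem_C0_iff.2 ⟨ε / 2, half_pos hε, δ, hδ, _,
    hF.fderiv_toComplex (half_lt_self hε) (EuclideanSpace.single j 1), funext fun x => ?_⟩
  have hFx := (hF.analyticOnNhd _ (toComplex_mem_tube hε x)).differentiableAt.hasFDerivAt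
  have hcomp := (hFx.restrictScalars ℝ).comp x (toComplexL d).hasFDerivAt
  exact (congrArg (fun l => l (EuclideanSpace.single j 1)) hcomp.fderiv).symm

end CauchyEstimate

section FourierExtension

variable {ε ε' δ η : ℝ} {f : E d → ℂ} {F : EC d → ℂ}

/-- The exponent `-i ∑ z_j ζ_j` of the Fourier integral, as a complex bilinear form. -/
def fourierPhase : EC d →L[ℂ] EC d →L[ℂ] ℂ :=
  -Complex.I • ∑ j, (EuclideanSpace.proj (𝕜 := ℂ) j : EC d →L[ℂ] ℂ).smulRight
    (EuclideanSpace.proj (𝕜 := ℂ) j : EC d →L[ℂ] ℂ)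

lemma fourierPhase_apply (z ζ : EC d) : fourierPhase z ζ = -(Complex.I * ∑ j, z j * ζ j) := by
  simp [fourierPhase]

lemma fourierPhase_toComplex (x ξ : E d) :
    fourierPhase (toComplex x) (toComplex ξ) = -(Complex.I * (inner ℝ ξ x : ℝ)) := by
  simp [fourierPhase_apply, PiLp.inner_apply]

lemma norm_fourierPhase_toComplex_le (x : E d) : ‖fourierPhase (toComplex x)‖ ≤ ‖x‖ := by
  refine ContinuousLinearMap.opNorm_le_bound _ (norm_nonneg x) fun ζ => ?_
  have h : ‖fourierPhase (toComplex x) ζ‖ = ‖inner ℂ (toComplex x) ζ‖ := by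
    simp [fourierPhase_apply, PiLp.inner_apply, mul_comm]
  rw [h, ← norm_toComplex x]
  exact norm_inner_le_norm _ _

lemma norm_exp_fourierPhase (z ζ : EC d) : ‖Complex.exp (fourierPhase z ζ)‖ =
    Real.exp (inner ℝ (imPart z) (rePart ζ) + inner ℝ (rePart z) (imPart ζ)) := by
  simp [Complex.norm_exp, fourierPhase_apply, PiLp.inner_apply, Finset.sum_add_distrib,
    mul_comm, add_comm]

lemma norm_exp_fourierPhase_toComplex_le (x : E d) (ζ : EC d) :
    ‖Complex.exp (fourierPhase (toComplex x) ζ)‖ ≤ Real.exp (‖x‖ * ‖imPart ζ‖) := by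
  simpa [norm_exp_fourierPhase] using real_inner_le_norm x (imPart ζ)

/-- The Fourier integral at a complex frequency. -/
def fourierExt (f : E d → ℂ) (ζ : EC d) : ℂ :=
  ∫ x : E d, Complex.exp (fourierPhase (toComplex x) ζ) * f x

lemma fourierExt_comp_toComplex (f : E d → ℂ) : fourierExt f ∘ toComplex = fourierT f := by
  ext ξ
  simp only [Function.comp_apply, fourierExt, fourierT, fourierPhase_toComplex]

lemma continuous_fourierPhase_toComplex :
    Continuous fun x : E d => fourierPhase (toComplex x) :=
  fourierPhase.continuous.comp (toComplexL d).continuous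

lemma aestronglyMeasurable_exp_fourierPhase_mul (hf : AEStronglyMeasurable f) (ζ : EC d) :
    AEStronglyMeasurable fun x => Complex.exp (fourierPhase (toComplex x) ζ) * f x :=
  (Complex.continuous_exp.comp (continuous_fourierPhase_toComplex.clm_apply
    continuous_const)).aestronglyMeasurable.mul hf

lemma analyticAt_fourierExt (hf : AEStronglyMeasurable f)
    (hint : Integrable fun x => Real.exp (δ * ‖x‖) * ‖f x‖) {ζ₀ : EC d} (hζ₀ : ζ₀ ∈ tube d δ) :
    AnalyticAt ℂ (fourierExt f) ζ₀ := by
  have hr : 0 < δ - ‖imPart ζ₀‖ := sub_pos.2 hζ₀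
  have hmeas := aestronglyMeasurable_exp_fourierPhase_mul hf ζ₀
  have hL := (continuous_fourierPhase_toComplex (d := d)).aestronglyMeasurable (μ := volume)
  have hseries := hasFPowerSeriesOnBall_integral_exp (r := (δ - ‖imPart ζ₀‖).toNNReal)
    (by simpa using hr) hmeas hL (hint.mono' (AEStronglyMeasurable.mul
      (Real.continuous_exp.comp_aestronglyMeasurable (hL.norm.const_mul _)) hmeas.norm)
      (Filter.Eventually.of_forall fun x => ?_))
  · have hshift := hseries.comp_sub ζ₀
    rw [zero_add] at hshift
    refine hshift.analyticAt.congr (Filter.Eventually.of_forall fun ζ => ?_)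
    simp only [fourierExt, smul_eq_mul, mul_right_comm _ (f _), ← Complex.exp_add, map_sub,
      add_sub_cancel]
  · rw [Real.norm_of_nonneg (by positivity), Real.coe_toNNReal _ hr.le, norm_mul, ← mul_assoc]
    gcongr
    calc Real.exp ((δ - ‖imPart ζ₀‖) * ‖fourierPhase (toComplex x)‖) *
          ‖Complex.exp (fourierPhase (toComplex x) ζ₀)‖
        ≤ Real.exp ((δ - ‖imPart ζ₀‖) * ‖x‖) * Real.exp (‖x‖ * ‖imPart ζ₀‖) := by
          gcongr
          · exact norm_fourierPhase_toComplex_le x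
          · exact norm_exp_fourierPhase_toComplex_le x ζ₀
      _ = Real.exp (δ * ‖x‖) := by rw [← Real.exp_add]; ring_nf

lemma tubeGrowth_fourierExt (hf : AEStronglyMeasurable f)
    (hint : Integrable fun x => Real.exp (δ * ‖x‖) * ‖f x‖) :
    TubeGrowth δ 0 (fourierExt f) := by
  refine ⟨fun ζ hζ => analyticAt_fourierExt hf hint hζ, ∫ x, Real.exp (δ * ‖x‖) * ‖f x‖,
    integral_nonneg fun x => by positivity, fun ζ hζ => ?_⟩
  rw [zero_mul, Real.exp_zero, mul_one]
  refine norm_integral_le_of_norm_le hint (Filter.Eventually.of_forall fun x => ?_)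
  rw [norm_mul]
  gcongr
  refine (norm_exp_fourierPhase_toComplex_le x ζ).trans ?_
  rw [mul_comm]
  gcongr
  exact le_of_lt hζ

lemma tubeGrowth_exp_fourierPhase (ε : ℝ) (ζ : EC d) :
    TubeGrowth ε ‖imPart ζ‖ fun z => Complex.exp (fourierPhase z ζ) := by
  refine ⟨fun z _ => ((fourierPhase.flip ζ).analyticAt z).cexp, Real.exp (ε * ‖rePart ζ‖),
    (Real.exp_pos _).le, fun z hz => ?_⟩
  have hre : inner ℝ (rePart z) (imPart ζ) ≤ ‖imPart ζ‖ * ‖rePart z‖ :=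
    (real_inner_le_norm _ _).trans_eq (mul_comm _ _)
  have him : inner ℝ (imPart z) (rePart ζ) ≤ ε * ‖rePart ζ‖ :=
    (real_inner_le_norm _ _).trans (mul_le_mul_of_nonneg_right (le_of_lt hz) (norm_nonneg _))
  rw [norm_exp_fourierPhase, ← Real.exp_add]
  gcongr

lemma TubeGrowth.fourierExt_eq_integral_shift (hF : TubeGrowth ε (-δ) F) {ζ : EC d}
    (hζ : ‖imPart ζ‖ < δ) {v : E d} (hv : ‖v‖ < ε) :
    fourierExt (F ∘ toComplex) ζ = ∫ x : E d,
      Complex.exp (fourierPhase (toComplex x + Complex.I • toComplex v) ζ) *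
        F (toComplex x + Complex.I • toComplex v) := by
  have hmul := (tubeGrowth_exp_fourierPhase ε ζ).mul hF
  rw [show ‖imPart ζ‖ + -δ = -(δ - ‖imPart ζ‖) by ring] at hmul
  exact (TubeGrowth.integral_add_I_smul hmul (sub_pos.2 hζ) hv).symm

lemma TubeGrowth.norm_fourierExt_le (hF : TubeGrowth ε (-δ) F) (hη : η < δ) :
    ∃ K ≥ 0, ∀ ζ ∈ tube d η, ∀ v : E d, ‖v‖ < ε →
      ‖fourierExt (F ∘ toComplex) ζ‖ ≤ K * Real.exp (inner ℝ v (rePart ζ)) := by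
  obtain ⟨K, hK, hFK⟩ := hF.exists_bound
  refine ⟨K * ∫ x : E d, Real.exp (-((δ - η) * ‖x‖)), by positivity, fun ζ hζ v hv => ?_⟩
  rw [hF.fourierExt_eq_integral_shift (lt_trans hζ hη) hv, mul_right_comm, ← integral_const_mul]
  refine norm_integral_le_of_norm_le
    ((integrable_exp_neg_mul_norm volume (sub_pos.2 hη)).const_mul _)
    (Filter.Eventually.of_forall fun x => ?_)
  have hmem : toComplex x + Complex.I • toComplex v ∈ tube d ε := by simpa [tube, imPart_add]
  have hx : inner ℝ x (imPart ζ) ≤ η * ‖x‖ := by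
    rw [mul_comm]
    exact (real_inner_le_norm _ _).trans (by gcongr; exact le_of_lt hζ)
  have hFx := hFK _ hmem
  simp only [rePart_add, rePart_toComplex, rePart_smul_toComplex, Complex.I_re, zero_smul,
    add_zero] at hFx
  calc ‖Complex.exp (fourierPhase (toComplex x + Complex.I • toComplex v) ζ) *
        F (toComplex x + Complex.I • toComplex v)‖
      ≤ Real.exp (inner ℝ v (rePart ζ) + η * ‖x‖) * (K * Real.exp (-δ * ‖x‖)) := by
        rw [norm_mul, norm_exp_fourierPhase]
        gcongr
        · simp [imPart_add]
        · simpa [rePart_add] using hx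
    _ = K * Real.exp (inner ℝ v (rePart ζ)) * (Real.exp (η * ‖x‖) * Real.exp (-δ * ‖x‖)) := by
        rw [Real.exp_add]; ring
    _ = K * Real.exp (inner ℝ v (rePart ζ)) * Real.exp (-((δ - η) * ‖x‖)) := by
        rw [← Real.exp_add]; ring_nf

lemma exists_norm_le_inner_eq_neg_mul_norm {V : Type*} [NormedAddCommGroup V]
    [InnerProductSpace ℝ V] {t : ℝ} (ht : 0 ≤ t) (u : V) :
    ∃ v : V, ‖v‖ ≤ t ∧ inner ℝ v u = -(t * ‖u‖) := by
  refine ⟨-(t * ‖u‖⁻¹) • u, ?_, ?_⟩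
  · rw [norm_smul, norm_neg, norm_mul, norm_inv, norm_norm, Real.norm_of_nonneg ht, mul_assoc]
    exact mul_le_of_le_one_right ht inv_mul_le_one
  · rcases eq_or_ne u 0 with rfl | hu
    · simp
    · rw [real_inner_smul_left, real_inner_self_eq_norm_sq]
      field_simp

lemma TubeGrowth.fourierExt_comp_toComplex (hF : TubeGrowth ε (-δ) F) (hη : η < δ) (hε' : 0 ≤ ε')
    (hε : ε' < ε) : TubeGrowth η (-ε') (fourierExt (F ∘ toComplex)) := by
  have hε₀ : 0 < ε := hε'.trans_lt hε
  obtain ⟨K, -, hFK⟩ := hF.exists_bound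
  have hcont : Continuous (F ∘ toComplex) := hF.analyticOnNhd.continuousOn.comp_continuous
    (toComplexL d).continuous (toComplex_mem_tube hε₀)
  have hint : Integrable fun x => Real.exp (η * ‖x‖) * ‖(F ∘ toComplex) x‖ := by
    refine ((integrable_exp_neg_mul_norm volume (sub_pos.2 hη)).const_mul K).mono'
      ((Continuous.mul (by fun_prop) hcont.norm).aestronglyMeasurable)
      (Filter.Eventually.of_forall fun x => ?_)
    rw [Real.norm_of_nonneg (by positivity)]
    calc Real.exp (η * ‖x‖) * ‖F (toComplex x)‖
        ≤ Real.exp (η * ‖x‖) * (K * Real.exp (-δ * ‖x‖)) := by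
          gcongr; exact hFK _ (toComplex_mem_tube hε₀ x)
      _ = K * Real.exp (-((δ - η) * ‖x‖)) := by
          rw [mul_left_comm, ← Real.exp_add]; ring_nf
  obtain ⟨M, hM, hFM⟩ := hF.norm_fourierExt_le hη
  refine ⟨(tubeGrowth_fourierExt hcont.aestronglyMeasurable hint).analyticOnNhd, M, hM,
    fun ζ hζ => ?_⟩
  obtain ⟨v, hv, hvζ⟩ := exists_norm_le_inner_eq_neg_mul_norm hε' (rePart ζ)
  simpa [hvζ] using hFM ζ hζ v (hv.trans_lt hε)

theorem fourierT_mem_C0 (hf : f ∈ C0 d) : fourierT f ∈ C0 d := by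
  obtain ⟨ε, hε, δ, hδ, F, hF, rfl⟩ := mem_C0_iff.1 hf
  exact mem_C0_iff.2 ⟨δ / 2, half_pos hδ, ε / 2, half_pos hε, _,
    hF.fourierExt_comp_toComplex (half_lt_self hδ) (half_pos hε).le
      (half_lt_self hε), ConvAn.fourierExt_comp_toComplex _⟩

end FourierExtension

section Inversion
variable {f g : E d → ℂ}

/-- The inverse Fourier transform `x ↦ (2π)^{-d} ∫ e^{i⟨ξ, x⟩} g(ξ) dξ`, normalised so that it
inverts `fourierT`. -/
def invFourierT (g : E d → ℂ) (x : E d) : ℂ :=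
  ((2 * Real.pi : ℝ) : ℂ)⁻¹ ^ d * ∫ ξ : E d, Complex.exp (Complex.I * (inner ℝ ξ x : ℝ)) * g ξ

lemma invFourierT_apply (g : E d → ℂ) (x : E d) :
    invFourierT g x = ((2 * Real.pi : ℝ) : ℂ)⁻¹ ^ d * fourierT g (-x) := by
  simp [invFourierT, fourierT, real_inner_comm]

lemma fourierT_eq_fourier (f : E d → ℂ) (ξ : E d) :
    fourierT f ξ = FourierTransform.fourier f ((2 * Real.pi)⁻¹ • ξ) := by
  rw [Real.fourier_eq', fourierT]
  refine integral_congr_ae (Filter.Eventually.of_forall fun x => ?_)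
  simp only [inner_smul_right, smul_eq_mul, real_inner_comm]
  congr 2
  push_cast
  field_simp

theorem invFourierT_fourierT (hc : Continuous f) (hf : Integrable f)
    (hf' : Integrable (fourierT f)) : invFourierT (fourierT f) = f := by
  have hpi : (2 * Real.pi) ≠ 0 := by positivity
  have heq : FourierTransform.fourier f = fun w => fourierT f ((2 * Real.pi) • w) := by
    ext w
    rw [fourierT_eq_fourier, inv_smul_smul₀ hpi]
  have hint : Integrable (FourierTransform.fourier f) := by
    rw [heq]
    exact (integrable_comp_smul_iff volume (fourierT f) hpi).2 hf'
  have hinv := hc.fourierInv_fourier_eq hf hint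
  ext x
  conv_rhs => rw [← hinv, Real.fourierInv_eq', heq]
  have := Measure.integral_comp_smul (volume : Measure (E d))
    (fun ξ => Complex.exp (Complex.I * (inner ℝ ξ x : ℝ)) * fourierT f ξ) (2 * Real.pi)
  rw [invFourierT]
  simp only [finrank_euclideanSpace, Fintype.card_fin] at this
  rw [abs_of_nonneg (by positivity), Complex.real_smul] at this
  push_cast at this ⊢
  rw [inv_pow, ← this]
  refine integral_congr_ae (Filter.Eventually.of_forall fun w => ?_)
  simp only [inner_smul_left, smul_eq_mul, conj_trivial]
  push_cast
  ring_nf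

lemma fourierT_comp_neg (f : E d → ℂ) (ξ : E d) :
    fourierT (fun x => f (-x)) ξ = fourierT f (-ξ) := by
  rw [fourierT, fourierT, ← integral_neg_eq_self]
  simp

lemma fourierT_const_mul (c : ℂ) (f : E d → ℂ) : fourierT (fun x => c * f x) = c • fourierT f := by
  ext ξ
  simp only [fourierT, Pi.smul_apply, smul_eq_mul, ← integral_const_mul]
  exact integral_congr_ae (Filter.Eventually.of_forall fun x => by simp only; ring)

lemma fourierT_invFourierT_eq (g : E d → ℂ) :
    fourierT (invFourierT g) = invFourierT (fourierT g) := by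
  ext ξ
  have : invFourierT g = fun x => ((2 * Real.pi : ℝ) : ℂ)⁻¹ ^ d * fourierT g (-x) :=
    funext (invFourierT_apply g)
  rw [this, fourierT_const_mul, invFourierT_apply, Pi.smul_apply, fourierT_comp_neg, smul_eq_mul]

lemma invFourierT_mem_C0 (hg : g ∈ C0 d) : invFourierT g ∈ C0 d := by
  have : invFourierT g = ((2 * Real.pi : ℝ) : ℂ)⁻¹ ^ d • fun x => fourierT g (-x) :=
    funext (invFourierT_apply g)
  rw [this]
  exact smul_mem_C0 _ (comp_neg_mem_C0 (fourierT_mem_C0 hg))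

lemma invFourierT_fourierT_of_mem_C0 (hf : f ∈ C0 d) : invFourierT (fourierT f) = f :=
  invFourierT_fourierT (continuous_of_mem_C0 hf) (integrable_of_mem_C0 hf)
    (integrable_of_mem_C0 (fourierT_mem_C0 hf))

lemma fourierT_invFourierT_of_mem_C0 (hg : g ∈ C0 d) : fourierT (invFourierT g) = g := by
  rw [fourierT_invFourierT_eq, invFourierT_fourierT_of_mem_C0 hg]

lemma fourierT_injOn_C0 : Set.InjOn fourierT (C0 d) := fun f hf g hg h => by
  rw [← invFourierT_fourierT_of_mem_C0 hf, h, invFourierT_fourierT_of_mem_C0 hg]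

lemma integrable_exp_mul (hf : Integrable f) (ξ : E d) :
    Integrable fun x : E d => Complex.exp (-(Complex.I * (inner ℝ ξ x : ℝ))) * f x := by
  refine hf.bdd_mul (c := 1) (by fun_prop) (Filter.Eventually.of_forall fun x => ?_)
  rw [Complex.norm_exp]
  simp

lemma fourierT_add (hf : Integrable f) (hg : Integrable g) :
    fourierT (f + g) = fourierT f + fourierT g := by
  ext ξ
  simp only [fourierT, Pi.add_apply, mul_add]
  exact integral_add (integrable_exp_mul hf ξ) (integrable_exp_mul hg ξ)

lemma fourierT_sum {ι : Type*} {s : Finset ι} {f : ι → E d → ℂ}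
    (hf : ∀ i ∈ s, Integrable (f i)) : fourierT (∑ i ∈ s, f i) = ∑ i ∈ s, fourierT (f i) := by
  ext ξ
  simp only [fourierT, Finset.sum_apply, Finset.mul_sum]
  exact integral_finsetSum s fun i hi => integrable_exp_mul (hf i hi) ξ

lemma fourierT_smul (c : ℂ) (f : E d → ℂ) : fourierT (c • f) = c • fourierT f :=
  fourierT_const_mul c f

end Inversion

section PartialDerivatives

variable {f g : E d → ℂ}

lemma contDiff_partialDeriv (hf : ContDiff ℝ ∞ f) (i : Fin d) : ContDiff ℝ ∞ (partialDeriv i f) :=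
  (hf.fderiv_right (m := ∞) (by simp)).clm_apply contDiff_const

lemma partialDeriv_comm (hf : ContDiff ℝ ∞ f) (i j : Fin d) :
    partialDeriv i (partialDeriv j f) = partialDeriv j (partialDeriv i f) := by
  have hd : ∀ x, DifferentiableAt ℝ (fderiv ℝ f) x := fun x =>
    ((hf.fderiv_right (m := ∞) (by simp)).differentiable (by simp)) x
  have key : ∀ (i j : Fin d) (x : E d), partialDeriv i (partialDeriv j f) x =
      fderiv ℝ (fderiv ℝ f) x (EuclideanSpace.single i 1) (EuclideanSpace.single j 1) := by
    intro i j x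
    have : partialDeriv j f = fun y => fderiv ℝ f y (EuclideanSpace.single j 1) := rfl
    rw [this, partialDeriv, fderiv_clm_apply (hd x) (differentiableAt_const _)]
    simp
  ext x
  rw [key, key]
  have hf₂ : ContDiff ℝ 2 f := hf.of_le (WithTop.coe_le_coe.2 le_top)
  exact (hf₂.contDiffAt.isSymmSndFDerivAt (by simp)).eq _ _

lemma partialDeriv_add (hf : ContDiff ℝ ∞ f) (hg : ContDiff ℝ ∞ g) (i : Fin d) :
    partialDeriv i (f + g) = partialDeriv i f + partialDeriv i g := by
  ext x
  simp only [partialDeriv, Pi.add_apply]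
  rw [fderiv_add (hf.differentiable (by simp) x) (hg.differentiable (by simp) x)]
  rfl

lemma partialDeriv_mul (hf : ContDiff ℝ ∞ f) (hg : ContDiff ℝ ∞ g) (i : Fin d) :
    partialDeriv i (f * g) = partialDeriv i f * g + f * partialDeriv i g := by
  ext x
  simp only [Pi.add_apply, Pi.mul_apply, partialDeriv]
  rw [fderiv_mul (hf.differentiable (by simp) x) (hg.differentiable (by simp) x)]
  simp
  ring

@[simp] lemma partialDeriv_const (c : ℂ) (i : Fin d) : partialDeriv i (fun _ : E d => c) = 0 := by
  ext x
  simp [partialDeriv]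

lemma partialDeriv_coord (i j : Fin d) :
    partialDeriv i (fun x : E d => (x j : ℂ)) = fun _ => if i = j then 1 else 0 := by
  ext x
  have h : HasFDerivAt (fun x : E d => (x j : ℂ))
      (Complex.ofRealCLM.comp (EuclideanSpace.proj (𝕜 := ℝ) j : E d →L[ℝ] ℝ)) x :=
    (Complex.ofRealCLM.comp (EuclideanSpace.proj (𝕜 := ℝ) j : E d →L[ℝ] ℝ)).hasFDerivAt
  rw [partialDeriv, h.fderiv]
  rcases eq_or_ne i j with rfl | hij
  · simp
  · simp [hij, hij.symm]

lemma partialDeriv_congr {x : E d} (h : f =ᶠ[𝓝 x] g) (i : Fin d) :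
    partialDeriv i f =ᶠ[𝓝 x] partialDeriv i g :=
  (Filter.EventuallyEq.fderiv (𝕜 := ℝ) h).mono fun y hy => by simp only [partialDeriv, hy]

lemma fourierT_partialDeriv (j : Fin d) (hf : Differentiable ℝ f) (hint : Integrable f)
    (hint' : Integrable (partialDeriv j f)) (ξ : E d) :
    fourierT (partialDeriv j f) ξ = Complex.I * (ξ j : ℂ) * fourierT f ξ := by
  set e : E d → ℂ := fun x => Complex.exp (-(Complex.I * (inner ℝ ξ x : ℝ)))
  have hexp : ∀ x, HasFDerivAt e (e x • -(Complex.I • Complex.ofRealCLM.comp (innerSL ℝ ξ))) x :=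
    fun x => (((Complex.ofRealCLM.comp (innerSL ℝ ξ)).hasFDerivAt.const_mul Complex.I).neg).cexp
  have hexp' : ∀ x, fderiv ℝ e x (EuclideanSpace.single j 1) =
      -(Complex.I * (ξ j : ℂ)) * e x := fun x => by
    rw [(hexp x).fderiv]
    simp [mul_comm, EuclideanSpace.inner_single_right]
  have hint_mul : Integrable fun x => -(Complex.I * (ξ j : ℂ)) * (e x * f x) :=
    (integrable_exp_mul hint ξ).const_mul _
  calc fourierT (partialDeriv j f) ξ
      = ∫ x, e x * fderiv ℝ f x (EuclideanSpace.single j 1) := rfl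
    _ = -∫ x, fderiv ℝ e x (EuclideanSpace.single j 1) * f x := by
        refine integral_mul_fderiv_eq_neg_fderiv_mul_of_integrable ?_
          (integrable_exp_mul hint' ξ) (integrable_exp_mul hint ξ)
          (fun x _ => (hexp x).differentiableAt) fun x _ => hf x
        simpa only [hexp', mul_assoc] using hint_mul
    _ = Complex.I * (ξ j : ℂ) * fourierT f ξ := by
        simp only [hexp', mul_assoc, neg_mul, integral_neg, neg_neg, integral_const_mul]
        rfl

end PartialDerivatives

section MultiDerivatives

variable {f g : E d → ℂ}

lemma multiIndex_induction {σ : Type*} {P : (σ →₀ ℕ) → Prop} (zero : P 0)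
    (add_single : ∀ I i, P I → P (I + Finsupp.single i 1)) (I : σ →₀ ℕ) : P I := by
  induction I using Finsupp.induction with
  | zero => exact zero
  | single_add i n I _ _ ih =>
    rw [add_comm]
    clear * - ih add_single
    induction n with
    | zero => simpa using ih
    | succ n ihn => simpa only [Finsupp.single_add, ← add_assoc] using add_single _ i ihn

lemma contDiff_iterate_partialDeriv (hf : ContDiff ℝ ∞ f) (i : Fin d) (n : ℕ) :
    ContDiff ℝ ∞ ((partialDeriv i)^[n] f) := by
  induction n with
  | zero => exact hf
  | succ n ih => rw [Function.iterate_succ_apply']; exact contDiff_partialDeriv ih i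

lemma iterate_partialDeriv_comm (hf : ContDiff ℝ ∞ f) (i j : Fin d) (n : ℕ) :
    (partialDeriv i)^[n] (partialDeriv j f) = partialDeriv j ((partialDeriv i)^[n] f) := by
  induction n with
  | zero => rfl
  | succ n ih =>
    rw [Function.iterate_succ_apply', Function.iterate_succ_apply', ih,
      partialDeriv_comm (contDiff_iterate_partialDeriv hf i n)]

/-- The part of `multiDeriv I f` that only differentiates in the directions of `l`; it allows
induction over the directions. -/
def listDeriv (l : List (Fin d)) (I : Fin d →₀ ℕ) (f : E d → ℂ) : E d → ℂ :=
  l.foldr (fun i g => (partialDeriv i)^[I i] g) f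

lemma listDeriv_cons (i : Fin d) (l : List (Fin d)) (I : Fin d →₀ ℕ) (f : E d → ℂ) :
    listDeriv (i :: l) I f = (partialDeriv i)^[I i] (listDeriv l I f) := rfl

lemma contDiff_listDeriv (hf : ContDiff ℝ ∞ f) (l : List (Fin d)) (I : Fin d →₀ ℕ) :
    ContDiff ℝ ∞ (listDeriv l I f) := by
  induction l with
  | nil => exact hf
  | cons i l ih => exact contDiff_iterate_partialDeriv ih i _

lemma listDeriv_partialDeriv (hf : ContDiff ℝ ∞ f) (l : List (Fin d)) (I : Fin d →₀ ℕ)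
    (j : Fin d) : listDeriv l I (partialDeriv j f) = partialDeriv j (listDeriv l I f) := by
  induction l with
  | nil => rfl
  | cons i l ih =>
    rw [listDeriv_cons, listDeriv_cons, ih, iterate_partialDeriv_comm (contDiff_listDeriv hf l I)]

lemma listDeriv_add_single (hf : ContDiff ℝ ∞ f) {l : List (Fin d)} (hl : l.Nodup)
    (I : Fin d →₀ ℕ) (j : Fin d) :
    listDeriv l (I + Finsupp.single j 1) f =
      if j ∈ l then partialDeriv j (listDeriv l I f) else listDeriv l I f := by
  induction l with
  | nil => simp [listDeriv]
  | cons i l ih =>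
    rw [List.nodup_cons] at hl
    rw [listDeriv_cons, listDeriv_cons, ih hl.2]
    rcases eq_or_ne i j with rfl | hij
    · simp only [hl.1, if_false, List.mem_cons, true_or, if_true, Finsupp.add_apply,
        Finsupp.single_eq_same, Function.iterate_succ_apply']
    · simp only [List.mem_cons, hij.symm, false_or, Finsupp.add_apply,
        Finsupp.single_eq_of_ne hij, add_zero]
      split_ifs
      · rw [iterate_partialDeriv_comm (contDiff_listDeriv hf l I)]
      · rfl

lemma contDiff_multiDeriv (hf : ContDiff ℝ ∞ f) (I : Fin d →₀ ℕ) :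
    ContDiff ℝ ∞ (multiDeriv I f) :=
  contDiff_listDeriv hf _ I

lemma multiDeriv_partialDeriv (hf : ContDiff ℝ ∞ f) (I : Fin d →₀ ℕ) (j : Fin d) :
    multiDeriv I (partialDeriv j f) = partialDeriv j (multiDeriv I f) :=
  listDeriv_partialDeriv hf _ I j

lemma multiDeriv_add_single (hf : ContDiff ℝ ∞ f) (I : Fin d →₀ ℕ) (j : Fin d) :
    multiDeriv (I + Finsupp.single j 1) f = partialDeriv j (multiDeriv I f) := by
  have := listDeriv_add_single hf (List.nodup_finRange d) I j
  rwa [if_pos (List.mem_finRange j)] at this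

@[simp] lemma multiDeriv_zero (f : E d → ℂ) : multiDeriv 0 f = f := by
  rw [multiDeriv]
  simp

@[simp] lemma multiDeriv_zero_right (I : Fin d →₀ ℕ) : multiDeriv I (0 : E d → ℂ) = 0 := by
  induction I using multiIndex_induction with
  | zero => simp
  | add_single I i ih =>
    rw [multiDeriv_add_single (f := 0) contDiff_const, ih]
    exact partialDeriv_const 0 i

lemma multiDeriv_add (hf : ContDiff ℝ ∞ f) (hg : ContDiff ℝ ∞ g) (I : Fin d →₀ ℕ) :
    multiDeriv I (f + g) = multiDeriv I f + multiDeriv I g := by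
  induction I using multiIndex_induction with
  | zero => simp
  | add_single I i ih =>
    rw [multiDeriv_add_single (f := f + g) (hf.add hg), multiDeriv_add_single hf,
      multiDeriv_add_single hg, ih,
      partialDeriv_add (contDiff_multiDeriv hf I) (contDiff_multiDeriv hg I)]

lemma multiDeriv_congr {x : E d} (hf : ContDiff ℝ ∞ f) (hg : ContDiff ℝ ∞ g) (h : f =ᶠ[𝓝 x] g)
    (I : Fin d →₀ ℕ) : multiDeriv I f =ᶠ[𝓝 x] multiDeriv I g := by
  induction I using multiIndex_induction with
  | zero => simpa using h
  | add_single I i ih =>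
    rw [multiDeriv_add_single hf, multiDeriv_add_single hg]
    exact partialDeriv_congr ih i

end MultiDerivatives

section TaylorSeries

variable {f g : E d → ℂ}

/-- The formal Taylor series of `f` at `x`, as a formal power series in the increment; up to a
rescaling of the variables, `symbolSeries p` is `taylorSeries p 0`. -/
def taylorSeries (f : E d → ℂ) (x : E d) : MvPowerSeries (Fin d) ℂ :=
  fun I => multiDeriv I f x / ((∏ i, (I i).factorial : ℕ) : ℂ)

lemma coeff_taylorSeries (f : E d → ℂ) (x : E d) (I : Fin d →₀ ℕ) :
    MvPowerSeries.coeff I (taylorSeries f x) =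
      multiDeriv I f x / ((∏ i, (I i).factorial : ℕ) : ℂ) := rfl

lemma prod_factorial_ne_zero (I : Fin d →₀ ℕ) : ((∏ i, (I i).factorial : ℕ) : ℂ) ≠ 0 :=
  Nat.cast_ne_zero.2 (Finset.prod_ne_zero_iff.2 fun i _ => (I i).factorial_ne_zero)

lemma prod_factorial_add_single (I : Fin d →₀ ℕ) (i : Fin d) :
    ∏ k, ((I + Finsupp.single i 1 : Fin d →₀ ℕ) k).factorial =
      (∏ k, (I k).factorial) * (I i + 1) := by
  rw [← Finset.mul_prod_erase _ _ (Finset.mem_univ i),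
    ← Finset.mul_prod_erase Finset.univ (fun k => (I k).factorial) (Finset.mem_univ i)]
  have : ∏ k ∈ Finset.univ.erase i, ((I + Finsupp.single i 1 : Fin d →₀ ℕ) k).factorial
      = ∏ k ∈ Finset.univ.erase i, (I k).factorial :=
    Finset.prod_congr rfl fun k hk => by simp [Finsupp.single_eq_of_ne (Finset.ne_of_mem_erase hk)]
  rw [this]
  simp [Nat.factorial_succ]
  ring

lemma pderiv_taylorSeries (hf : ContDiff ℝ ∞ f) (x : E d) (i : Fin d) :
    MvPowerSeries.pderiv ℂ i (taylorSeries f x) = taylorSeries (partialDeriv i f) x := by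
  ext I
  rw [MvPowerSeries.coeff_pderiv, coeff_taylorSeries, coeff_taylorSeries, multiDeriv_add_single hf,
    multiDeriv_partialDeriv hf, prod_factorial_add_single]
  have hfact := prod_factorial_ne_zero I
  have hsucc : (I i : ℂ) + 1 ≠ 0 := Nat.cast_add_one_ne_zero (I i)
  push_cast at hfact ⊢
  field_simp

lemma taylorSeries_add (hf : ContDiff ℝ ∞ f) (hg : ContDiff ℝ ∞ g) (x : E d) :
    taylorSeries (f + g) x = taylorSeries f x + taylorSeries g x := by
  ext I
  simp [coeff_taylorSeries, multiDeriv_add hf hg, add_div]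

lemma taylorSeries_mul (hf : ContDiff ℝ ∞ f) (hg : ContDiff ℝ ∞ g) (x : E d) :
    taylorSeries (f * g) x = taylorSeries f x * taylorSeries g x := by
  ext I
  induction I using multiIndex_induction generalizing f g with
  | zero =>
    simp only [MvPowerSeries.coeff_zero_eq_constantCoeff_apply, map_mul]
    simp only [← MvPowerSeries.coeff_zero_eq_constantCoeff_apply, coeff_taylorSeries]
    simp
  | add_single I i ih =>
    have hf' := contDiff_partialDeriv hf i
    have hg' := contDiff_partialDeriv hg i
    have hmul : ContDiff ℝ ∞ (f * g) := hf.mul hg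
    have hmul₁ : ContDiff ℝ ∞ (partialDeriv i f * g) := hf'.mul hg
    have hmul₂ : ContDiff ℝ ∞ (f * partialDeriv i g) := hf.mul hg'
    refine mul_right_cancel₀ (Nat.cast_add_one_ne_zero (I i)) ?_
    rw [← MvPowerSeries.coeff_pderiv, ← MvPowerSeries.coeff_pderiv, Derivation.leibniz,
      pderiv_taylorSeries hmul, pderiv_taylorSeries hf, pderiv_taylorSeries hg,
      partialDeriv_mul hf hg, taylorSeries_add hmul₁ hmul₂, map_add, map_add, ih hf' hg,
      ih hf hg', smul_eq_mul, smul_eq_mul, add_comm, mul_comm (taylorSeries g x)]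

lemma taylorSeries_const (c : ℂ) (x : E d) :
    taylorSeries (fun _ => c) x = MvPowerSeries.C c := by
  refine MvPowerSeries.pderiv.ext (fun i => ?_) ?_
  · rw [pderiv_taylorSeries contDiff_const, partialDeriv_const, MvPowerSeries.pderiv_C]
    ext I
    simp [coeff_taylorSeries]
  · rw [← MvPowerSeries.coeff_zero_eq_constantCoeff_apply, coeff_taylorSeries]
    simp

lemma contDiff_coord (j : Fin d) : ContDiff ℝ ∞ fun x : E d => (x j : ℂ) :=
  (Complex.ofRealCLM.comp (EuclideanSpace.proj (𝕜 := ℝ) j : E d →L[ℝ] ℝ)).contDiff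

lemma taylorSeries_coord (j : Fin d) (x : E d) :
    taylorSeries (fun x => (x j : ℂ)) x = MvPowerSeries.C (x j : ℂ) + MvPowerSeries.X j := by
  refine MvPowerSeries.pderiv.ext (fun i => ?_) ?_
  · rw [pderiv_taylorSeries (contDiff_coord j), partialDeriv_coord, taylorSeries_const, map_add,
      MvPowerSeries.pderiv_C, zero_add]
    rcases eq_or_ne i j with rfl | h
    · simp
    · rw [MvPowerSeries.pderiv_X_of_ne h.symm, if_neg h, map_zero]
  · rw [← MvPowerSeries.coeff_zero_eq_constantCoeff_apply, coeff_taylorSeries]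
    simp

lemma multiChoose_mul (I I' : Fin d →₀ ℕ) :
    multiChoose (I + I') I * ((∏ i, (I i).factorial) * ∏ i, (I' i).factorial) =
      ∏ i, ((I + I') i).factorial := by
  rw [multiChoose, ← Finset.prod_mul_distrib, ← Finset.prod_mul_distrib]
  refine Finset.prod_congr rfl fun i _ => ?_
  rw [Finsupp.add_apply, ← mul_assoc]
  simpa using Nat.choose_mul_factorial_mul_factorial (Nat.le_add_right (I i) (I' i))

lemma multiDeriv_mul (hf : ContDiff ℝ ∞ f) (hg : ContDiff ℝ ∞ g) (J : Fin d →₀ ℕ) :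
    multiDeriv J (f * g) = ∑ I ∈ Finset.HasAntidiagonal.antidiagonal J,
      (multiChoose (I.1 + I.2) I.1 : ℂ) • (multiDeriv I.1 f * multiDeriv I.2 g) := by
  ext x
  have h := congrArg (MvPowerSeries.coeff J) (taylorSeries_mul hf hg x)
  rw [MvPowerSeries.coeff_mul, coeff_taylorSeries, div_eq_iff (prod_factorial_ne_zero J),
    Finset.sum_mul] at h
  rw [h, Finset.sum_apply]
  refine Finset.sum_congr rfl fun I hI => ?_
  rw [Finset.HasAntidiagonal.mem_antidiagonal] at hI
  rw [coeff_taylorSeries, coeff_taylorSeries, ← hI, ← multiChoose_mul]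
  have hfact₁ := prod_factorial_ne_zero I.1
  have hfact₂ := prod_factorial_ne_zero I.2
  push_cast at hfact₁ hfact₂ ⊢
  simp only [Pi.smul_apply, Pi.mul_apply, smul_eq_mul]
  field_simp

end TaylorSeries

section Multinomial

variable {σ : Type*} {n : ℕ}

/-- The multi-index counting how often each value is taken by `φ`: the type of the monomial
`∏ k, X (φ k)`. -/
def countIndex (φ : Fin n → σ) : σ →₀ ℕ := ∑ k, Finsupp.single (φ k) 1

@[simp] lemma countIndex_zero (φ : Fin 0 → σ) : countIndex φ = 0 := by simp [countIndex]

lemma countIndex_succ (φ : Fin (n + 1) → σ) :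
    countIndex φ = countIndex (fun k => φ k.succ) + Finsupp.single (φ 0) 1 := by
  rw [countIndex, Fin.sum_univ_succ, add_comm, countIndex]

@[simp] lemma degree_countIndex (φ : Fin n → σ) : (countIndex φ).degree = n := by
  simp [countIndex]

variable [Fintype σ]

lemma prod_comp_eq_prod_pow_countIndex {R : Type*} [CommMonoid R] (ξ : σ → R) (φ : Fin n → σ) :
    ∏ k, ξ (φ k) = ∏ i, ξ i ^ countIndex φ i := by
  rw [← Finsupp.prod_fintype _ (fun i n => ξ i ^ n) (by simp), countIndex,
    ← Finsupp.prod_finsetSum_index (by simp) (by simp [pow_add])]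
  simp

lemma prod_factorial_mul_multinomial (I : σ →₀ ℕ) :
    (∏ i, (I i).factorial) * I.multinomial = I.degree.factorial := by
  rw [Finsupp.multinomial_eq_of_support_subset (Finset.subset_univ _), Nat.multinomial_spec,
    Finsupp.degree_eq_sum]

variable [DecidableEq σ]

lemma mem_finsuppAntidiag_univ {I : σ →₀ ℕ} :
    I ∈ Finset.finsuppAntidiag Finset.univ n ↔ I.degree = n := by
  simp [Finset.mem_finsuppAntidiag, Finsupp.degree_eq_sum]

lemma card_filter_countIndex_eq (I : σ →₀ ℕ) :
    (Finset.univ.filter fun φ : Fin I.degree → σ => countIndex φ = I).card = I.multinomial := by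
  have hcoeff := MvPolynomial.coeff_sum_X_pow_of_fintype (R := ℕ) I I.degree
  rw [if_pos (by rfl), Fintype.sum_pow, MvPolynomial.coeff_sum] at hcoeff
  have hmonomial : ∀ φ : Fin I.degree → σ, ∏ k, (MvPolynomial.X (φ k) : MvPolynomial σ ℕ) =
      MvPolynomial.monomial (countIndex φ) 1 := fun φ =>
    (MvPolynomial.monomial_sum_one _ _).symm
  simpa [hmonomial, MvPolynomial.coeff_monomial] using hcoeff

lemma sum_prod_mul_countIndex {K : Type*} [Field K] [CharZero K] (n : ℕ) (ξ : σ → K)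
    (H : (σ →₀ ℕ) → K) :
    ∑ φ : Fin n → σ, (∏ k, ξ (φ k)) * H (countIndex φ) =
      n.factorial * ∑ I ∈ Finset.finsuppAntidiag Finset.univ n,
        (∏ i, ξ i ^ I i) * (H I / ((∏ i, (I i).factorial : ℕ) : K)) := by
  simp only [prod_comp_eq_prod_pow_countIndex]
  rw [← Finset.sum_fiberwise_of_maps_to' (g := countIndex)
    (t := Finset.finsuppAntidiag Finset.univ n)
    (fun φ _ => mem_finsuppAntidiag_univ.2 (degree_countIndex φ))
    fun I => (∏ i, ξ i ^ I i) * H I, Finset.mul_sum]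
  refine Finset.sum_congr rfl fun I hI => ?_
  obtain rfl := mem_finsuppAntidiag_univ.1 hI
  have hfact : ((∏ i, (I i).factorial : ℕ) : K) ≠ 0 :=
    Nat.cast_ne_zero.2 (Finset.prod_ne_zero_iff.2 fun i _ => (I i).factorial_ne_zero)
  rw [Finset.sum_const, card_filter_countIndex_eq, nsmul_eq_mul,
    ← prod_factorial_mul_multinomial, Nat.cast_mul]
  field_simp

lemma hasSum_fiber_degree {X : Type*} [AddCommMonoid X] [TopologicalSpace X] (a : (σ →₀ ℕ) → X)
    (n : ℕ) : HasSum (fun I : {I : σ →₀ ℕ // I.degree = n} => a I)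
      (∑ I ∈ Finset.finsuppAntidiag Finset.univ n, a I) :=
  (Equiv.hasSum_iff (Equiv.subtypeEquivRight fun _ => mem_finsuppAntidiag_univ.symm)).2
    (Finset.hasSum _ a)

lemma hasSum_of_hasSum_degree {X : Type*} [NormedAddCommGroup X] [CompleteSpace X]
    {a : (σ →₀ ℕ) → X} {s : X}
    (hnorm : Summable fun n => ∑ I ∈ Finset.finsuppAntidiag Finset.univ n, ‖a I‖)
    (hs : HasSum (fun n => ∑ I ∈ Finset.finsuppAntidiag Finset.univ n, a I) s) : HasSum a s := by
  let e := Equiv.sigmaFiberEquiv (Finsupp.degree : (σ →₀ ℕ) → ℕ)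
  have hsum : Summable a := by
    refine Summable.of_norm (e.summable_iff.1 ?_)
    refine (summable_sigma_of_nonneg fun _ => norm_nonneg _).2
      ⟨fun n => (hasSum_fiber_degree (fun I => ‖a I‖) n).summable, ?_⟩
    exact hnorm.congr fun n => ((hasSum_fiber_degree (fun I => ‖a I‖) n).tsum_eq).symm
  rw [hs.unique ((e.hasSum_iff.2 hsum.hasSum).sigma fun n => hasSum_fiber_degree a n)]
  exact hsum.hasSum

end Multinomial

section TaylorExpansion

lemma norm_iteratedFDeriv_le_factorial_mul {𝕜 V W : Type*} [RCLike 𝕜] [NormedAddCommGroup V]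
    [NormedSpace 𝕜 V] [NormedAddCommGroup W] [NormedSpace 𝕜 W] [CompleteSpace W] {f : V → W}
    {p : FormalMultilinearSeries 𝕜 V W} {x : V} {r : ENNReal} (hp : HasFPowerSeriesOnBall f p x r)
    (n : ℕ) : ‖iteratedFDeriv 𝕜 n f x‖ ≤ n.factorial * ‖p n‖ := by
  refine ContinuousMultilinearMap.opNorm_le_bound (by positivity) fun v => ?_
  rw [hp.iteratedFDeriv_eq_sum_of_completeSpace]
  calc ‖∑ σ : Equiv.Perm (Fin n), p n fun i => v (σ i)‖
      ≤ ∑ σ : Equiv.Perm (Fin n), ‖p n fun i => v (σ i)‖ := norm_sum_le _ _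
    _ ≤ ∑ _σ : Equiv.Perm (Fin n), ‖p n‖ * ∏ i, ‖v i‖ := by
        refine Finset.sum_le_sum fun σ _ => ?_
        rw [← Equiv.prod_comp σ fun i => ‖v i‖]
        exact (p n).le_opNorm _
    _ = n.factorial * ‖p n‖ * ∏ i, ‖v i‖ := by simp [Fintype.card_perm, mul_assoc]

variable {f : E d → ℂ}

lemma iteratedFDeriv_single (hf : ContDiff ℝ ∞ f) {n : ℕ} (φ : Fin n → Fin d) (x : E d) :
    iteratedFDeriv ℝ n f x (fun k => EuclideanSpace.single (φ k) 1) =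
      multiDeriv (countIndex φ) f x := by
  induction n generalizing x with
  | zero => simp
  | succ n ih =>
    have hd : DifferentiableAt ℝ (iteratedFDeriv ℝ n f) x :=
      (hf.differentiable_iteratedFDeriv (by exact_mod_cast WithTop.coe_lt_top _)) x
    have htail : (fun y => iteratedFDeriv ℝ n f y fun k => EuclideanSpace.single (φ k.succ) 1) =
        multiDeriv (countIndex fun k => φ k.succ) f := funext fun y => ih (fun k => φ k.succ) y
    rw [iteratedFDeriv_succ_apply_left, countIndex_succ, multiDeriv_add_single hf, partialDeriv,
      ← htail, fderiv_continuousMultilinear_apply_const hd]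
    rfl

lemma iteratedFDeriv_diag_eq_sum (hf : ContDiff ℝ ∞ f) (n : ℕ) (x ξ : E d) :
    (iteratedFDeriv ℝ n f x fun _ => ξ) =
      n.factorial * ∑ I ∈ Finset.finsuppAntidiag Finset.univ n,
        (∏ i, (ξ i : ℂ) ^ I i) * MvPowerSeries.coeff I (taylorSeries f x) := by
  have hξ : ξ = ∑ j, ξ j • (EuclideanSpace.single j (1 : ℝ) : E d) := by
    ext i
    simp [Pi.single_apply]
  conv_lhs => rw [hξ]
  simp only [ContinuousMultilinearMap.map_sum, ContinuousMultilinearMap.map_smul_univ,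
    iteratedFDeriv_single hf, Complex.real_smul, Complex.ofReal_prod]
  exact sum_prod_mul_countIndex n (fun i => (ξ i : ℂ)) fun I => multiDeriv I f x

lemma sum_norm_taylorSeries_le (hf : ContDiff ℝ ∞ f) {n : ℕ} {x : E d} {C : ℝ}
    (hC : ‖iteratedFDeriv ℝ n f x‖ ≤ n.factorial * C) (ξ : E d) :
    ∑ I ∈ Finset.finsuppAntidiag Finset.univ n,
      ‖(∏ i, (ξ i : ℂ) ^ I i) * MvPowerSeries.coeff I (taylorSeries f x)‖ ≤
        C * (∑ i, |ξ i|) ^ n := by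
  have hmulti (φ : Fin n → Fin d) : ‖multiDeriv (countIndex φ) f x‖ ≤ n.factorial * C := by
    rw [← iteratedFDeriv_single hf φ]
    refine ((iteratedFDeriv ℝ n f x).le_opNorm _).trans ?_
    simpa using hC
  refine le_of_mul_le_mul_left ?_ (Nat.cast_pos.2 n.factorial_pos : (0 : ℝ) < n.factorial)
  calc (n.factorial : ℝ) * ∑ I ∈ Finset.finsuppAntidiag Finset.univ n,
        ‖(∏ i, (ξ i : ℂ) ^ I i) * MvPowerSeries.coeff I (taylorSeries f x)‖
      = ∑ φ : Fin n → Fin d, (∏ k, |ξ (φ k)|) * ‖multiDeriv (countIndex φ) f x‖ := by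
        rw [sum_prod_mul_countIndex n (fun i => |ξ i|) fun I => ‖multiDeriv I f x‖]
        simp only [coeff_taylorSeries, norm_mul, norm_div, norm_prod, norm_pow,
          Complex.norm_real, Complex.norm_natCast, Real.norm_eq_abs]
    _ ≤ ∑ φ : Fin n → Fin d, (∏ k, |ξ (φ k)|) * (n.factorial * C) := by
        gcongr with φ
        exact hmulti φ
    _ = n.factorial * (C * (∑ i, |ξ i|) ^ n) := by
        rw [← Finset.sum_mul, Fintype.sum_pow]
        ring

theorem hasSum_taylorSeries (hf : AnalyticOnNhd ℝ f Set.univ) (x : E d) :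
    ∃ U ∈ 𝓝 (0 : E d), ∀ ξ ∈ U, HasSum (fun I : Fin d →₀ ℕ =>
      (∏ i, (ξ i : ℂ) ^ I i) * MvPowerSeries.coeff I (taylorSeries f x)) (f (x + ξ)) := by
  have hcd : ContDiff ℝ ∞ f := hf.contDiff
  obtain ⟨p, r, hp⟩ := hf x (Set.mem_univ _)
  obtain ⟨s, hs0, hsr⟩ := ENNReal.lt_iff_exists_nnreal_btwn.1 hp.r_pos
  have hcont : Continuous fun ξ : E d => ∑ i, |ξ i| := by fun_prop
  refine ⟨{ξ | ∑ i, |ξ i| < s} ∩ Metric.eball 0 r, Filter.inter_mem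
    ((isOpen_lt hcont continuous_const).mem_nhds (by simpa using hs0))
    (Metric.eball_mem_nhds _ hp.r_pos), fun ξ ⟨hξs, hξr⟩ => hasSum_of_hasSum_degree ?_ ?_⟩
  · refine Summable.of_nonneg_of_le (fun n => Finset.sum_nonneg fun _ _ => norm_nonneg _)
      (fun n => ?_) (p.summable_norm_mul_pow (hsr.trans_le hp.r_le))
    refine (sum_norm_taylorSeries_le hcd (norm_iteratedFDeriv_le_factorial_mul hp n) ξ).trans ?_
    gcongr
    exact le_of_lt hξs
  · have hsum := hp.hasSum_iteratedFDeriv hξr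
    simp only [iteratedFDeriv_diag_eq_sum hcd, Complex.real_smul] at hsum
    refine hsum.congr_fun fun n => ?_
    push_cast
    rw [inv_mul_cancel_left₀ (Nat.cast_ne_zero.2 n.factorial_ne_zero)]

end TaylorExpansion

section Symbols

/-- The symbols of the pseudo-differential operators, as an algebra of functions. -/
def symbolRing (d : ℕ) : Subalgebra ℂ (E d → ℂ) where
  carrier := P0 d
  mul_mem' := mul_mem_P0
  add_mem' := add_mem_P0
  algebraMap_mem' := const_mem_P0

lemma symbolSeries_eq_rescale (p : E d → ℂ) :
    symbolSeries p = MvPowerSeries.rescale (fun _ => -Complex.I) (taylorSeries p 0) := by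
  ext I
  rw [MvPowerSeries.coeff_rescale, coeff_taylorSeries, Finsupp.prod, Finset.prod_pow_eq_pow_sum,
    ← Finsupp.degree_apply, ← mul_div_assoc]
  rfl

lemma symbolSeries_const (c : ℂ) : symbolSeries (fun _ : E d => c) = MvPowerSeries.C c := by
  rw [symbolSeries_eq_rescale, taylorSeries_const]
  ext I
  rw [MvPowerSeries.coeff_rescale, MvPowerSeries.coeff_C]
  split_ifs with h <;> simp [h]

/-- The formal power series in the `∂_j` of a symbol, as a homomorphism: composition of operators is
multiplication of symbols. -/
def symbolHom (d : ℕ) : symbolRing d →ₐ[ℂ] MvPowerSeries (Fin d) ℂ where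
  toFun p := symbolSeries (p : E d → ℂ)
  map_one' := symbolSeries_const 1
  map_mul' p q := by
    simp only [symbolSeries_eq_rescale, Subalgebra.coe_mul, ← map_mul,
      taylorSeries_mul (contDiff_of_mem_P0 p.2) (contDiff_of_mem_P0 q.2)]
  map_zero' := (symbolSeries_const 0).trans (map_zero _)
  map_add' p q := by
    simp only [symbolSeries_eq_rescale, Subalgebra.coe_add, ← map_add,
      taylorSeries_add (contDiff_of_mem_P0 p.2) (contDiff_of_mem_P0 q.2)]
  commutes' := symbolSeries_const

@[simp] lemma symbolHom_apply (p : symbolRing d) : symbolHom d p = symbolSeries (p : E d → ℂ) :=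
  rfl

/-- The symbol `iξ_j` of `∂_j`. -/
def coordSymbol (j : Fin d) : symbolRing d :=
  Complex.I • ⟨fun ξ => (ξ j : ℂ), coord_mem_P0 j⟩

@[simp] lemma coordSymbol_coe (j : Fin d) (ξ : E d) :
    (coordSymbol j : E d → ℂ) ξ = Complex.I * (ξ j : ℂ) := rfl

lemma symbolHom_coordSymbol (j : Fin d) : symbolHom d (coordSymbol j) = MvPowerSeries.X j := by
  rw [coordSymbol, map_smul, symbolHom_apply, symbolSeries_eq_rescale, taylorSeries_coord]
  ext I
  rw [MvPowerSeries.coeff_smul, MvPowerSeries.coeff_rescale, PiLp.zero_apply, Complex.ofReal_zero,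
    map_zero, zero_add, MvPowerSeries.coeff_X]
  split_ifs with h <;> simp [h]

/-- The symbol of a polynomial differential operator. -/
def polySymbol (d : ℕ) : MvPolynomial (Fin d) ℂ →ₐ[ℂ] symbolRing d :=
  MvPolynomial.aeval coordSymbol

lemma symbolHom_polySymbol (q : MvPolynomial (Fin d) ℂ) :
    symbolHom d (polySymbol d q) = (q : MvPowerSeries (Fin d) ℂ) := by
  have hcomp : (symbolHom d).comp (polySymbol d) = MvPolynomial.coeToMvPowerSeries.algHom ℂ :=
    MvPolynomial.algHom_ext fun j => by
      simpa [polySymbol] using symbolHom_coordSymbol j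
  simpa using DFunLike.congr_fun hcomp q

theorem opRing_eq_range_symbolHom : opRing d = (symbolHom d).range := by
  ext P
  constructor
  · rintro ⟨n, p, q, hp, rfl⟩
    refine sum_mem fun k _ => mul_mem ?_ ⟨_, symbolHom_polySymbol _⟩
    obtain ⟨s, hs, hsp⟩ := hp k
    exact ⟨⟨s, hs⟩, hsp⟩
  · rintro ⟨p, rfl⟩
    exact ⟨1, fun _ => symbolHom d p, fun _ => 1, fun _ => ⟨p, p.2, rfl⟩, by simp [polySeries]⟩

/-- The symbol of `∂_I`. -/
def monoSymbol (I : Fin d →₀ ℕ) : symbolRing d := I.prod fun i n => coordSymbol i ^ n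

@[simp] lemma monoSymbol_zero : monoSymbol (0 : Fin d →₀ ℕ) = 1 := Finsupp.prod_zero_index

lemma monoSymbol_add_single (I : Fin d →₀ ℕ) (j : Fin d) :
    monoSymbol (I + Finsupp.single j 1) = coordSymbol j * monoSymbol I := by
  rw [monoSymbol, Finsupp.prod_add_index' (by simp) (by simp [pow_add]), mul_comm]
  simp [monoSymbol]

lemma monoSymbol_coe (I : Fin d →₀ ℕ) (ξ : E d) :
    (monoSymbol I : E d → ℂ) ξ = Complex.I ^ I.degree * ∏ i, (ξ i : ℂ) ^ I i := by
  simp [monoSymbol, Finsupp.prod_fintype, mul_pow, Finset.prod_mul_distrib,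
    Finset.prod_pow_eq_pow_sum, Finsupp.degree_eq_sum]

lemma polySymbol_eq_sum (q : MvPolynomial (Fin d) ℂ) :
    polySymbol d q = ∑ I ∈ q.support, MvPolynomial.coeff I q • monoSymbol I := by
  rw [polySymbol, MvPolynomial.aeval_def, MvPolynomial.eval₂_eq]
  simp only [← Algebra.smul_def]
  rfl

lemma coeff_symbolSeries (p : E d → ℂ) (I : Fin d →₀ ℕ) :
    MvPowerSeries.coeff I (symbolSeries p) =
      (-Complex.I) ^ I.degree * MvPowerSeries.coeff I (taylorSeries p 0) := by
  rw [coeff_taylorSeries, ← mul_div_assoc]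
  rfl

theorem hasSum_symbolSeries {p : E d → ℂ} (hp : AnalyticOnNhd ℝ p Set.univ) :
    ∃ U ∈ 𝓝 (0 : E d), ∀ ξ ∈ U, HasSum (fun I : Fin d →₀ ℕ =>
      MvPowerSeries.coeff I (symbolSeries p) * (monoSymbol I : E d → ℂ) ξ) (p ξ) := by
  obtain ⟨U, hU, hsum⟩ := hasSum_taylorSeries hp 0
  simp only [zero_add] at hsum
  refine ⟨U, hU, fun ξ hξ => (hsum ξ hξ).congr_fun fun I => ?_⟩
  have hI : (-Complex.I) ^ I.degree * Complex.I ^ I.degree = 1 := by simp [← mul_pow]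
  rw [coeff_symbolSeries, monoSymbol_coe]
  linear_combination (MvPowerSeries.coeff I (taylorSeries p 0) * ∏ i, (ξ i : ℂ) ^ I i) * hI

lemma symbolHom_injective : Function.Injective (symbolHom d) := by
  rw [injective_iff_map_eq_zero]
  intro p hp
  have han := analyticOnNhd_of_mem_P0 p.2
  obtain ⟨U, hU, hsum⟩ := hasSum_symbolSeries han
  have hzero : ∀ ξ ∈ U, (p : E d → ℂ) ξ = 0 := fun ξ hξ =>
    (hsum ξ hξ).unique (by simp [← symbolHom_apply, hp])
  exact Subtype.ext (han.eq_of_eventuallyEq (g := 0) analyticOnNhd_const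
    (Filter.eventually_of_mem hU hzero))

variable {f : E d → ℂ}

lemma fourierT_partialDeriv_of_mem_C0 (hf : f ∈ C0 d) (j : Fin d) :
    fourierT (partialDeriv j f) = (coordSymbol j : E d → ℂ) * fourierT f :=
  funext fun ξ => fourierT_partialDeriv j ((contDiff_of_mem_C0 hf).differentiable (by simp))
    (integrable_of_mem_C0 hf) (integrable_of_mem_C0 (partialDeriv_mem_C0 j hf)) ξ

lemma multiDeriv_mem_C0 (hf : f ∈ C0 d) (I : Fin d →₀ ℕ) : multiDeriv I f ∈ C0 d := by
  induction I using multiIndex_induction with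
  | zero => simpa using hf
  | add_single I j ih =>
    rw [multiDeriv_add_single (contDiff_of_mem_C0 hf)]
    exact partialDeriv_mem_C0 j ih

lemma fourierT_multiDeriv (hf : f ∈ C0 d) (I : Fin d →₀ ℕ) :
    fourierT (multiDeriv I f) = (monoSymbol I : E d → ℂ) * fourierT f := by
  induction I using multiIndex_induction with
  | zero => simp
  | add_single I j ih =>
    rw [multiDeriv_add_single (contDiff_of_mem_C0 hf),
      fourierT_partialDeriv_of_mem_C0 (multiDeriv_mem_C0 hf I), ih, monoSymbol_add_single,
      ← mul_assoc]
    rfl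

theorem funcSpace_eq_C0 : funcSpace d = C0 d :=
  Set.ext fun _ => ⟨fun h => by simpa using h.2 0,
    fun h => ⟨contDiff_of_mem_C0 h, multiDeriv_mem_C0 h⟩⟩

end Symbols

section Convolution

variable {f g : E d → ℂ}

lemma bddAbove_range_norm_of_mem_C0 (hf : f ∈ C0 d) : BddAbove (Set.range fun x => ‖f x‖) := by
  obtain ⟨δ, hδ, K, hK⟩ := exists_bound_of_mem_C0 hf
  refine ⟨|K|, Set.forall_mem_range.2 fun x => (hK x).trans ?_⟩
  have hexp : Real.exp (-(δ * ‖x‖)) ≤ 1 := Real.exp_le_one_iff.2 (neg_nonpos.2 (by positivity))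
  calc K * Real.exp (-(δ * ‖x‖)) ≤ |K| * Real.exp (-(δ * ‖x‖)) := by gcongr; exact le_abs_self K
    _ ≤ |K| := mul_le_of_le_one_right (abs_nonneg K) hexp

lemma convolutionExists_of_mem_C0 (hf : f ∈ C0 d) (hg : g ∈ C0 d) :
    ConvolutionExists f g (ContinuousLinearMap.mul ℂ ℂ) volume := fun _ =>
  BddAbove.convolutionExistsAt (s := Set.univ) _
    ((bddAbove_range_norm_of_mem_C0 hg).mono (Set.image_subset_range _ _)) MeasurableSet.univ
    (Set.subset_univ _) (integrable_of_mem_C0 hf).integrableOn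
    (continuous_of_mem_C0 hg).aestronglyMeasurable

lemma fourierT_convolution (hf : Integrable f) (hg : Integrable g) :
    fourierT (convolution f g (ContinuousLinearMap.mul ℂ ℂ) volume) = fourierT f * fourierT g := by
  ext ξ
  simp only [Pi.mul_apply, fourierT_eq_fourier]
  exact Real.fourier_mul_convolution_eq hf hg _

lemma convolution_eq_invFourierT (hf : f ∈ C0 d) (hg : g ∈ C0 d) :
    convolution f g (ContinuousLinearMap.mul ℂ ℂ) volume =
      invFourierT (fourierT f * fourierT g) := by
  have hf_int := integrable_of_mem_C0 hf
  have hg_int := integrable_of_mem_C0 hg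
  rw [← fourierT_convolution hf_int hg_int, invFourierT_fourierT]
  · exact BddAbove.continuous_convolution_right_of_integrable _ (bddAbove_range_norm_of_mem_C0 hg)
      hf_int (continuous_of_mem_C0 hg)
  · exact hf_int.integrable_convolution _ hg_int
  · rw [fourierT_convolution hf_int hg_int]
    exact integrable_of_mem_C0
      (mul_mem_C0 (C0_subset_P0 (fourierT_mem_C0 hf)) (fourierT_mem_C0 hg))

end Convolution

section Sech

variable {a : ℝ}

lemma norm_cosh_le (w : ℂ) : ‖Complex.cosh w‖ ≤ Real.exp |w.re| := by
  rw [Complex.cosh, norm_div, Complex.norm_ofNat, div_le_iff₀ two_pos]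
  refine (norm_add_le _ _).trans ?_
  rw [Complex.norm_exp, Complex.norm_exp, Complex.neg_re, mul_two]
  gcongr
  exacts [le_abs_self _, neg_le_abs _]

lemma re_cosh (w : ℂ) : (Complex.cosh w).re = Real.cosh w.re * Real.cos w.im := by
  conv_lhs => rw [← Complex.re_add_im w, Complex.cosh_add, Complex.cosh_mul_I, Complex.sinh_mul_I]
  simp [← Complex.ofReal_cosh, ← Complex.ofReal_sinh, ← Complex.ofReal_cos, ← Complex.ofReal_sin]

lemma exp_abs_re_le_norm_cosh {w : ℂ} (hw : |w.im| ≤ 1) :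
    Real.exp |w.re| / 4 ≤ ‖Complex.cosh w‖ := by
  have hcos : 1 / 2 ≤ Real.cos w.im := by
    linarith [Real.one_sub_sq_div_two_le_cos (x := w.im), (sq_le_one_iff_abs_le_one _).2 hw]
  have hcosh : Real.exp |w.re| / 2 ≤ Real.cosh w.re := by
    rw [← Real.cosh_abs, Real.cosh_eq]
    linarith [Real.exp_pos (-|w.re|)]
  calc Real.exp |w.re| / 4 = Real.exp |w.re| / 2 * (1 / 2) := by ring
    _ ≤ Real.cosh w.re * Real.cos w.im := by gcongr
    _ = (Complex.cosh w).re := (re_cosh w).symm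
    _ ≤ ‖Complex.cosh w‖ := Complex.re_le_norm _

/-- The function `∏ cosh (a z_j)` on `ℂ^d`: entire, of growth rate at most `a d` on every tube, and
without zeros on the tube of width `a⁻¹`. -/
def coshProd (a : ℝ) (z : EC d) : ℂ := ∏ j, Complex.cosh (a * z j)

/-- The function `∏ (cosh (a x_j))⁻¹` on `ℝ^d`: an element of `C0` without zeros, which serves both
as a divisor of other elements of `C0` and as an approximation of `1`. -/
def sechProd (d : ℕ) (a : ℝ) (x : E d) : ℂ := (coshProd a (toComplex x))⁻¹

lemma analyticOnNhd_coshProd (a : ℝ) (s : Set (EC d)) : AnalyticOnNhd ℂ (coshProd a) s :=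
  fun z _ => Finset.analyticAt_fun_prod _ fun j _ =>
    (Complex.differentiable_cosh.analyticAt _).comp
      (analyticAt_const.mul ((EuclideanSpace.proj (𝕜 := ℂ) j).analyticAt z))

lemma tubeGrowth_coshProd (ε : ℝ) (ha : 0 ≤ a) :
    TubeGrowth ε (a * d) (coshProd a : EC d → ℂ) := by
  refine ⟨analyticOnNhd_coshProd a _, 1, zero_le_one, fun z _ => ?_⟩
  rw [coshProd, norm_prod, one_mul]
  calc ∏ j, ‖Complex.cosh (a * z j)‖ ≤ ∏ _j : Fin d, Real.exp (a * ‖rePart z‖) := by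
        gcongr with j
        refine (norm_cosh_le _).trans ?_
        rw [Complex.re_ofReal_mul, abs_mul, abs_of_nonneg ha]
        gcongr
        exact PiLp.norm_apply_le (rePart z) j
    _ = Real.exp (a * d * ‖rePart z‖) := by
        rw [Finset.prod_const, ← Real.exp_nat_mul, Finset.card_univ, Fintype.card_fin]
        ring_nf

lemma norm_le_sum_abs (x : E d) : ‖x‖ ≤ ∑ j, |x j| := by
  rw [EuclideanSpace.norm_eq, Real.sqrt_le_iff]
  exact ⟨Finset.sum_nonneg fun j _ => abs_nonneg _,
    Finset.sum_sq_le_sq_sum_of_nonneg fun j _ => abs_nonneg _⟩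

lemma exp_le_norm_coshProd (ha : 0 < a) {z : EC d} (hz : z ∈ tube d a⁻¹) :
    Real.exp (a * ‖rePart z‖) / 4 ^ d ≤ ‖coshProd a z‖ := by
  have him (j : Fin d) : |(a * z j).im| ≤ 1 := by
    rw [Complex.im_ofReal_mul, abs_mul, abs_of_pos ha]
    calc a * |(z j).im| ≤ a * ‖imPart z‖ := by
          gcongr
          exact PiLp.norm_apply_le (imPart z) j
      _ ≤ a * a⁻¹ := by gcongr; exact le_of_lt hz
      _ = 1 := mul_inv_cancel₀ ha.ne'
  calc Real.exp (a * ‖rePart z‖) / 4 ^ d ≤ Real.exp (∑ j, a * |(z j).re|) / 4 ^ d := by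
        rw [← Finset.mul_sum]
        gcongr
        exact norm_le_sum_abs (rePart z)
    _ = ∏ j : Fin d, (Real.exp |(a * z j).re| / 4) := by
        rw [Finset.prod_div_distrib, Real.exp_sum]
        simp [abs_mul, abs_of_pos ha]
    _ ≤ ∏ j, ‖Complex.cosh (a * z j)‖ := by
        gcongr with j
        exact exp_abs_re_le_norm_cosh (him j)
    _ = ‖coshProd a z‖ := (norm_prod _ _).symm

lemma coshProd_ne_zero (ha : 0 < a) {z : EC d} (hz : z ∈ tube d a⁻¹) : coshProd a z ≠ 0 :=
  norm_pos_iff.1 (lt_of_lt_of_le (by positivity) (exp_le_norm_coshProd ha hz))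

lemma sechProd_ne_zero (ha : 0 < a) (x : E d) : sechProd d a x ≠ 0 :=
  inv_ne_zero (coshProd_ne_zero ha (toComplex_mem_tube (inv_pos.2 ha) x))

lemma tubeGrowth_coshProd_inv (ha : 0 < a) :
    TubeGrowth a⁻¹ (-a) (coshProd a : EC d → ℂ)⁻¹ := by
  refine ⟨(analyticOnNhd_coshProd a _).inv fun z hz => coshProd_ne_zero ha hz, 4 ^ d,
    by positivity, fun z hz => ?_⟩
  rw [Pi.inv_apply, norm_inv, neg_mul, Real.exp_neg, ← div_eq_mul_inv, ← inv_div]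
  exact inv_anti₀ (by positivity) (exp_le_norm_coshProd ha hz)

lemma sechProd_mem_C0 (ha : 0 < a) : sechProd d a ∈ C0 d :=
  mem_C0_iff.2 ⟨a⁻¹, inv_pos.2 ha, a, ha, _, tubeGrowth_coshProd_inv ha, rfl⟩

lemma eventually_inv_sechProd_mul_mem_C0 {h : E d → ℂ} (hh : h ∈ C0 d) :
    ∀ᶠ a in 𝓝[>] 0, (sechProd d a)⁻¹ * h ∈ C0 d := by
  obtain ⟨ε, hε, δ, hδ, H, hH, rfl⟩ := mem_C0_iff.1 hh
  have hsmall : ∀ᶠ a : ℝ in 𝓝[>] 0, a * d < δ / 2 :=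
    nhdsWithin_le_nhds ((continuous_mul_const (d : ℝ)).tendsto' 0 0 (zero_mul _)
      |>.eventually_lt_const (half_pos hδ))
  filter_upwards [hsmall, self_mem_nhdsWithin] with a had ha
  refine mem_C0_iff.2 ⟨ε, hε, δ / 2, half_pos hδ, coshProd a * H,
    ((tubeGrowth_coshProd ε (le_of_lt ha)).mul hH).mono le_rfl (by linarith), ?_⟩
  ext x
  simp [sechProd]

lemma norm_sechProd_le_one (a : ℝ) (x : E d) : ‖sechProd d a x‖ ≤ 1 := by
  rw [sechProd, norm_inv, coshProd, norm_prod, ← Finset.prod_inv_distrib]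
  refine Finset.prod_le_one (fun j _ => by positivity) fun j _ => inv_le_one_of_one_le₀ ?_
  rw [toComplex_apply, ← Complex.ofReal_mul, ← Complex.ofReal_cosh, Complex.norm_real,
    Real.norm_of_nonneg (Real.cosh_pos _).le]
  exact Real.one_le_cosh _

lemma tendsto_sechProd (x : E d) :
    Filter.Tendsto (fun a => sechProd d a x) (𝓝[>] 0) (𝓝 1) := by
  have hcont : Continuous fun a : ℝ => coshProd a (toComplex x) := by
    unfold coshProd
    fun_prop
  have hlim : Filter.Tendsto (fun a : ℝ => coshProd a (toComplex x)) (𝓝[>] 0) (𝓝 1) :=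
    (hcont.tendsto' 0 1 (by simp [coshProd])).mono_left nhdsWithin_le_nhds
  simpa [sechProd] using hlim.inv₀ one_ne_zero

end Sech

section CompactSupport

variable {φ : E d → ℂ}

lemma hasCompactSupport_multiDeriv (hφ : ContDiff ℝ ∞ φ) (hc : HasCompactSupport φ)
    (I : Fin d →₀ ℕ) : HasCompactSupport (multiDeriv I φ) := by
  induction I using multiIndex_induction with
  | zero => simpa using hc
  | add_single I j ih =>
    rw [multiDeriv_add_single hφ]
    exact ih.fderiv_apply ℝ _

lemma fourierT_partialDeriv_of_hasCompactSupport (hφ : ContDiff ℝ ∞ φ) (hc : HasCompactSupport φ)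
    (j : Fin d) : fourierT (partialDeriv j φ) = (coordSymbol j : E d → ℂ) * fourierT φ :=
  funext fun ξ => fourierT_partialDeriv j (hφ.differentiable (by simp))
    (hφ.continuous.integrable_of_hasCompactSupport hc)
    ((contDiff_partialDeriv hφ j).continuous.integrable_of_hasCompactSupport
      (hc.fderiv_apply ℝ _)) ξ

lemma fourierT_multiDeriv_of_hasCompactSupport (hφ : ContDiff ℝ ∞ φ) (hc : HasCompactSupport φ)
    (I : Fin d →₀ ℕ) : fourierT (multiDeriv I φ) = (monoSymbol I : E d → ℂ) * fourierT φ := by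
  induction I using multiIndex_induction with
  | zero => simp
  | add_single I j ih =>
    rw [multiDeriv_add_single hφ, fourierT_partialDeriv_of_hasCompactSupport
      (contDiff_multiDeriv hφ I) (hasCompactSupport_multiDeriv hφ hc I), ih,
      monoSymbol_add_single, ← mul_assoc]
    rfl

lemma integrable_fourierT_of_hasCompactSupport (hφ : ContDiff ℝ ∞ φ) (hc : HasCompactSupport φ) :
    Integrable (fourierT φ) := by
  have hint : Integrable (FourierTransform.fourier φ) := by
    have hint := (FourierTransform.fourier (hc.toSchwartzMap hφ)).integrable (μ := volume)
    rwa [SchwartzMap.fourier_coe] at hint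
  rw [funext (fourierT_eq_fourier φ)]
  exact (integrable_comp_smul_iff volume _ (by positivity)).2 hint

lemma fourierT_mem_P0_of_hasCompactSupport (hφ : Continuous φ) (hc : HasCompactSupport φ) :
    fourierT φ ∈ P0 d := by
  have hint : Integrable fun x => Real.exp (1 * ‖x‖) * ‖φ x‖ :=
    Continuous.integrable_of_hasCompactSupport (by fun_prop) hc.norm.mul_left
  exact mem_P0_iff.2 ⟨1, one_pos, fourierExt φ, fun δ hδ =>
    (tubeGrowth_fourierExt hφ.aestronglyMeasurable hint).mono le_rfl hδ.le,
    fourierExt_comp_toComplex φ⟩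

end CompactSupport

section Density

variable {φ : E d → ℂ} {a : ℝ}

lemma norm_invFourierT_sub_le {F G : E d → ℂ} (hF : Integrable F) (hG : Integrable G) (x : E d) :
    ‖invFourierT F x - invFourierT G x‖ ≤
      ‖((2 * Real.pi : ℝ) : ℂ)⁻¹ ^ d‖ * ∫ ξ, ‖F ξ - G ξ‖ := by
  have hnorm (ξ : E d) : ‖Complex.exp (Complex.I * (inner ℝ ξ x : ℝ))‖ = 1 := by
    rw [Complex.norm_exp]
    simp
  have hint {H : E d → ℂ} (hH : Integrable H) :
      Integrable fun ξ : E d => Complex.exp (Complex.I * (inner ℝ ξ x : ℝ)) * H ξ :=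
    hH.bdd_mul (c := 1) (by fun_prop) (Filter.Eventually.of_forall fun ξ => (hnorm ξ).le)
  rw [invFourierT, invFourierT, ← mul_sub, norm_mul, ← integral_sub (hint hF) (hint hG)]
  gcongr
  refine (norm_integral_le_integral_norm _).trans_eq ?_
  simp only [← mul_sub, norm_mul, hnorm, one_mul]

/-- The regularisation of `φ` with Fourier transform `φ̂ ∏ (cosh (a ξ_j))⁻¹`. -/
def regularise (φ : E d → ℂ) (a : ℝ) : E d → ℂ := invFourierT (fourierT φ * sechProd d a)

lemma fourierT_mul_sechProd_mem_C0 (hφ : Continuous φ) (hc : HasCompactSupport φ) (ha : 0 < a) :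
    fourierT φ * sechProd d a ∈ C0 d :=
  mul_mem_C0 (fourierT_mem_P0_of_hasCompactSupport hφ hc) (sechProd_mem_C0 ha)

lemma regularise_mem_C0 (hφ : Continuous φ) (hc : HasCompactSupport φ) (ha : 0 < a) :
    regularise φ a ∈ C0 d :=
  invFourierT_mem_C0 (fourierT_mul_sechProd_mem_C0 hφ hc ha)

lemma multiDeriv_regularise (hφ : ContDiff ℝ ∞ φ) (hc : HasCompactSupport φ) (ha : 0 < a)
    (I : Fin d →₀ ℕ) : multiDeriv I (regularise φ a) = regularise (multiDeriv I φ) a := by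
  have hreg := regularise_mem_C0 hφ.continuous hc ha
  calc multiDeriv I (regularise φ a)
      = invFourierT (fourierT (multiDeriv I (regularise φ a))) :=
        (invFourierT_fourierT_of_mem_C0 (multiDeriv_mem_C0 hreg I)).symm
    _ = invFourierT ((monoSymbol I : E d → ℂ) * (fourierT φ * sechProd d a)) := by
        rw [fourierT_multiDeriv hreg, regularise, fourierT_invFourierT_of_mem_C0
          (fourierT_mul_sechProd_mem_C0 hφ.continuous hc ha)]
    _ = regularise (multiDeriv I φ) a := by
        rw [regularise, fourierT_multiDeriv_of_hasCompactSupport hφ hc, mul_assoc]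

lemma eventually_aestronglyMeasurable_sechProd :
    ∀ᶠ a in 𝓝[>] (0 : ℝ), AEStronglyMeasurable (sechProd d a) :=
  eventually_mem_nhdsWithin.mono fun _ ha =>
    (continuous_of_mem_C0 (sechProd_mem_C0 ha)).aestronglyMeasurable

lemma tendsto_integral_norm_mul_sechProd_sub {F : E d → ℂ} (hF : Integrable F) :
    Filter.Tendsto (fun a => ∫ ξ, ‖(F * sechProd d a) ξ - F ξ‖) (𝓝[>] 0) (𝓝 0) := by
  suffices Filter.Tendsto (fun a => ∫ ξ, ‖(F * sechProd d a) ξ - F ξ‖) (𝓝[>] 0)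
      (𝓝 (∫ _ : E d, (0 : ℝ))) by simpa only [integral_zero] using this
  refine tendsto_integral_filter_of_dominated_convergence (fun ξ => 2 * ‖F ξ‖)
    (eventually_aestronglyMeasurable_sechProd.mono fun a ha => ((hF.1.mul ha).sub hF.1).norm)
    (Filter.Eventually.of_forall fun a => Filter.Eventually.of_forall fun ξ => ?_)
    (hF.norm.const_mul 2) (Filter.Eventually.of_forall fun ξ => ?_)
  · rw [norm_norm, Pi.mul_apply, two_mul]
    refine norm_sub_le_of_le ?_ le_rfl
    rw [norm_mul]
    exact mul_le_of_le_one_right (norm_nonneg _) (norm_sechProd_le_one a ξ)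
  · simpa using (((tendsto_sechProd ξ).const_mul (F ξ)).sub_const (F ξ)).norm

lemma eventually_norm_regularise_sub_lt (hφ : ContDiff ℝ ∞ φ) (hc : HasCompactSupport φ) {η : ℝ}
    (hη : 0 < η) : ∀ᶠ a in 𝓝[>] (0 : ℝ), ∀ x, ‖regularise φ a x - φ x‖ < η := by
  have hF := integrable_fourierT_of_hasCompactSupport hφ hc
  have hlim := (tendsto_integral_norm_mul_sechProd_sub hF).const_mul
    ‖((2 * Real.pi : ℝ) : ℂ)⁻¹ ^ d‖
  rw [mul_zero] at hlim
  filter_upwards [hlim.eventually_lt_const hη, eventually_aestronglyMeasurable_sechProd]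
    with a ha hmeas x
  have hint : Integrable (fourierT φ * sechProd d a) :=
    hF.mul_bdd (c := 1) hmeas (Filter.Eventually.of_forall (norm_sechProd_le_one a))
  have hinv : invFourierT (fourierT φ) = φ :=
    invFourierT_fourierT hφ.continuous (hφ.continuous.integrable_of_hasCompactSupport hc) hF
  calc ‖regularise φ a x - φ x‖
      = ‖invFourierT (fourierT φ * sechProd d a) x - invFourierT (fourierT φ) x‖ := by
        rw [hinv, regularise]
    _ < η := (norm_invFourierT_sub_le hint hF x).trans_lt ha

lemma exists_contDiff_hasCompactSupport_eventuallyEq {g : E d → ℂ} (hg : ContDiff ℝ ∞ g)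
    {K : Set (E d)} (hK : IsCompact K) :
    ∃ φ : E d → ℂ, ContDiff ℝ ∞ φ ∧ HasCompactSupport φ ∧ ∀ x ∈ K, φ =ᶠ[𝓝 x] g := by
  obtain ⟨R, hR, hKR⟩ := hK.isBounded.subset_ball_lt 0 0
  let χ : ContDiffBump (0 : E d) := ⟨R, R + 1, hR, by linarith⟩
  refine ⟨fun x => (χ x : ℂ) * g x, (Complex.ofRealCLM.contDiff.comp χ.contDiff).mul hg,
    (χ.hasCompactSupport.comp_left Complex.ofReal_zero).mul_right, fun x hx => ?_⟩
  filter_upwards [Metric.isOpen_ball.mem_nhds (hKR hx)] with y hy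
  simp [χ.one_of_mem_closedBall (Metric.ball_subset_closedBall hy)]

theorem exists_mem_C0_norm_multiDeriv_sub_lt {g : E d → ℂ} (hg : ContDiff ℝ ∞ g) {K : Set (E d)}
    (hK : IsCompact K) (N : ℕ) {η : ℝ} (hη : 0 < η) :
    ∃ f ∈ C0 d, ∀ I : Fin d →₀ ℕ, I.degree ≤ N →
      ∀ x ∈ K, ‖multiDeriv I f x - multiDeriv I g x‖ < η := by
  obtain ⟨φ, hφ, hc, heq⟩ := exists_contDiff_hasCompactSupport_eventuallyEq hg hK
  have hclose : ∀ᶠ a in 𝓝[>] (0 : ℝ), ∀ I ∈ {I : Fin d →₀ ℕ | I.degree ≤ N},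
      ∀ x, ‖regularise (multiDeriv I φ) a x - multiDeriv I φ x‖ < η :=
    (Filter.eventually_all_finite (Finsupp.finite_of_degree_le N)).2 fun I _ =>
      eventually_norm_regularise_sub_lt (contDiff_multiDeriv hφ I)
        (hasCompactSupport_multiDeriv hφ hc I) hη
  obtain ⟨a, hclose, ha⟩ := (hclose.and eventually_mem_nhdsWithin).exists
  refine ⟨regularise φ a, regularise_mem_C0 hφ.continuous hc ha, fun I hI x hx => ?_⟩
  rw [multiDeriv_regularise hφ hc ha, ← (multiDeriv_congr hφ hg (heq x hx) I).eq_of_nhds]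
  exact hclose I hI x

end Density

section TensorProducts

variable {R M N Q : Type*} [CommSemiring R] [AddCommMonoid M] [AddCommMonoid N] [AddCommMonoid Q]
  [Module R M] [Module R N] [Module R Q]

lemma exists_finset_forall_eq_tmul (t : M ⊗[R] N) : ∃ s : Finset M, ∀ u : M,
    (∀ f ∈ s, f ∈ Submodule.span R {u}) → ∃ g : N, t = u ⊗ₜ[R] g := by
  classical
  induction t with
  | zero => exact ⟨∅, fun u _ => ⟨0, (TensorProduct.tmul_zero _ _).symm⟩⟩
  | tmul f g =>
    refine ⟨{f}, fun u hu => ?_⟩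
    obtain ⟨r, rfl⟩ := Submodule.mem_span_singleton.1 (hu f (Finset.mem_singleton_self f))
    exact ⟨r • g, TensorProduct.smul_tmul _ _ _⟩
  | add x y hx hy =>
    obtain ⟨s, hs⟩ := hx
    obtain ⟨s', hs'⟩ := hy
    refine ⟨s ∪ s', fun u hu => ?_⟩
    obtain ⟨g, rfl⟩ := hs u fun f hf => hu f (Finset.mem_union_left _ hf)
    obtain ⟨g', rfl⟩ := hs' u fun f hf => hu f (Finset.mem_union_right _ hf)
    exact ⟨g + g', (TensorProduct.tmul_add _ _ _).symm⟩

lemma bijective_lift_of_common_divisor (μ : M →ₗ[R] N →ₗ[R] Q)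
    (hdiv : ∀ s : Finset M, ∃ u, (∀ f ∈ s, f ∈ Submodule.span R {u}) ∧ Function.Injective (μ u))
    (hsurj : ∀ m, ∃ f g, μ f g = m) : Function.Bijective (TensorProduct.lift μ) := by
  classical
  refine ⟨fun t t' htt' => ?_, fun m => ?_⟩
  · obtain ⟨s, hs⟩ := exists_finset_forall_eq_tmul t
    obtain ⟨s', hs'⟩ := exists_finset_forall_eq_tmul t'
    obtain ⟨u, hu, hinj⟩ := hdiv (s ∪ s')
    obtain ⟨g, rfl⟩ := hs u fun f hf => hu f (Finset.mem_union_left _ hf)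
    obtain ⟨g', rfl⟩ := hs' u fun f hf => hu f (Finset.mem_union_right _ hf)
    rw [TensorProduct.lift.tmul, TensorProduct.lift.tmul] at htt'
    rw [hinj htt']
  · obtain ⟨f, g, rfl⟩ := hsurj m
    exact ⟨f ⊗ₜ g, TensorProduct.lift.tmul _ _⟩

end TensorProducts

section Action

/-- The function space, as a non-unital algebra under pointwise multiplication. -/
def funcs (d : ℕ) : NonUnitalSubalgebra ℂ (E d → ℂ) where
  carrier := C0 d
  add_mem' := add_mem_C0
  zero_mem' := zero_mem_C0
  mul_mem' hf hg := mul_mem_C0 (C0_subset_P0 hf) hg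
  smul_mem' c _ hf := smul_mem_C0 c hf

/-- The ring of operators, as formal power series in the `∂_j`. -/
abbrev ops (d : ℕ) : Subring (MvPowerSeries (Fin d) ℂ) := (symbolHom d).range.toSubring

/-- The identification of operators with their symbols. -/
def opEquiv (d : ℕ) : symbolRing d ≃+* ops d :=
  (AlgEquiv.ofInjective (symbolHom d) symbolHom_injective).toRingEquiv

/-- The symbol of an operator. -/
def symbol (P : ops d) : symbolRing d := (opEquiv d).symm P

lemma symbolHom_symbol (P : ops d) : symbolHom d (symbol P) = P :=
  congrArg Subtype.val ((opEquiv d).apply_symm_apply P)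

lemma symbol_eq {P : ops d} {p : symbolRing d} (h : (P : MvPowerSeries (Fin d) ℂ) = symbolHom d p) :
    symbol P = p :=
  symbolHom_injective ((symbolHom_symbol P).trans h)

lemma funcs_ext {f g : funcs d} (h : fourierT (f : E d → ℂ) = fourierT (g : E d → ℂ)) : f = g :=
  Subtype.ext (fourierT_injOn_C0 f.2 g.2 h)

/-- The element of the function space with a given Fourier transform. -/
def ofFourier (g : E d → ℂ) (hg : g ∈ C0 d) : funcs d := ⟨invFourierT g, invFourierT_mem_C0 hg⟩

@[simp] lemma fourierT_ofFourier (g : E d → ℂ) (hg : g ∈ C0 d) :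
    fourierT (ofFourier g hg : E d → ℂ) = g := fourierT_invFourierT_of_mem_C0 hg

lemma fourierT_funcs_add (f g : funcs d) :
    fourierT ((f + g : funcs d) : E d → ℂ) = fourierT (f : E d → ℂ) + fourierT (g : E d → ℂ) :=
  fourierT_add (integrable_of_mem_C0 f.2) (integrable_of_mem_C0 g.2)

lemma fourierT_funcs_smul (c : ℂ) (f : funcs d) :
    fourierT ((c • f : funcs d) : E d → ℂ) = c • fourierT (f : E d → ℂ) :=
  fourierT_smul c (f : E d → ℂ)

lemma fourierT_funcs_zero : fourierT ((0 : funcs d) : E d → ℂ) = 0 := by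
  simpa using fourierT_funcs_smul 0 (0 : funcs d)

instance : SMul (ops d) (funcs d) where
  smul P f := ofFourier ((symbol P : E d → ℂ) * fourierT (f : E d → ℂ))
    (mul_mem_C0 (symbol P).2 (fourierT_mem_C0 f.2))

lemma coe_ops_smul (P : ops d) (f : funcs d) :
    ((P • f : funcs d) : E d → ℂ) = pseudoDiff (symbol P : E d → ℂ) f := rfl

lemma fourierT_ops_smul (P : ops d) (f : funcs d) :
    fourierT ((P • f : funcs d) : E d → ℂ) = (symbol P : E d → ℂ) * fourierT (f : E d → ℂ) :=
  fourierT_ofFourier _ _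

instance opsModule : Module (ops d) (funcs d) where
  one_smul f := funcs_ext (by simp [fourierT_ops_smul, symbol])
  mul_smul P Q f := funcs_ext (by simp [fourierT_ops_smul, symbol, mul_assoc])
  smul_zero P := funcs_ext (by rw [fourierT_ops_smul, fourierT_funcs_zero, mul_zero])
  smul_add P f g := funcs_ext (by simp only [fourierT_ops_smul, fourierT_funcs_add, mul_add])
  add_smul P Q f := funcs_ext (by
    simp only [fourierT_ops_smul, fourierT_funcs_add, symbol, map_add, Subalgebra.coe_add, add_mul])
  zero_smul f := funcs_ext (by rw [fourierT_ops_smul, fourierT_funcs_zero]; simp [symbol])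

lemma fourierT_sum_smul_multiDeriv {f : E d → ℂ} (hf : f ∈ C0 d) (q : MvPolynomial (Fin d) ℂ) :
    fourierT (∑ I ∈ q.support, MvPolynomial.coeff I q • multiDeriv I f) =
      (polySymbol d q : E d → ℂ) * fourierT f := by
  rw [fourierT_sum fun I _ => (integrable_of_mem_C0 (multiDeriv_mem_C0 hf I)).smul _,
    polySymbol_eq_sum, AddSubmonoidClass.coe_finsetSum, Finset.sum_mul]
  refine Finset.sum_congr rfl fun I _ => ?_
  rw [fourierT_smul, fourierT_multiDeriv hf, Subalgebra.coe_smul, smul_mul_assoc]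

lemma coe_ops_smul_of_eq_coe {P : ops d} {q : MvPolynomial (Fin d) ℂ}
    (hP : (P : MvPowerSeries (Fin d) ℂ) = q) (f : funcs d) :
    ((P • f : funcs d) : E d → ℂ) =
      ∑ I ∈ q.support, MvPolynomial.coeff I q • multiDeriv I (f : E d → ℂ) := by
  refine fourierT_injOn_C0 (P • f : funcs d).2 (sum_mem (S := funcs d) fun I _ =>
    smul_mem_C0 _ (multiDeriv_mem_C0 f.2 I)) ?_
  rw [fourierT_ops_smul, symbol_eq (hP.trans (symbolHom_polySymbol q).symm),
    fourierT_sum_smul_multiDeriv f.2]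

lemma exists_nhds_hasSum_ops_smul (P : ops d) : ∃ U ∈ 𝓝 (0 : E d), ∀ f : funcs d, ∀ ξ ∈ U,
    HasSum (fun I : Fin d →₀ ℕ => MvPowerSeries.coeff I (P : MvPowerSeries (Fin d) ℂ) *
      fourierT (multiDeriv I (f : E d → ℂ)) ξ) (fourierT ((P • f : funcs d) : E d → ℂ) ξ) := by
  obtain ⟨U, hU, hsum⟩ := hasSum_symbolSeries (analyticOnNhd_of_mem_P0 (symbol P).2)
  refine ⟨U, hU, fun f ξ hξ => ?_⟩
  rw [fourierT_ops_smul, Pi.mul_apply]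
  refine ((hsum ξ hξ).mul_right (fourierT (f : E d → ℂ) ξ)).congr_fun fun I => ?_
  rw [fourierT_multiDeriv f.2, ← symbolHom_apply, symbolHom_symbol, Pi.mul_apply, mul_assoc]

lemma fourierT_multiDeriv_mul {f g : E d → ℂ} (hf : f ∈ C0 d) (hg : g ∈ C0 d) (J : Fin d →₀ ℕ)
    (ξ : E d) : fourierT (multiDeriv J (f * g)) ξ =
      ∑ I ∈ Finset.HasAntidiagonal.antidiagonal J, (multiChoose (I.1 + I.2) I.1 : ℂ) *
        fourierT (multiDeriv I.1 f * multiDeriv I.2 g) ξ := by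
  have hmem (I I' : Fin d →₀ ℕ) : multiDeriv I f * multiDeriv I' g ∈ C0 d :=
    mul_mem_C0 (C0_subset_P0 (multiDeriv_mem_C0 hf I)) (multiDeriv_mem_C0 hg I')
  rw [multiDeriv_mul (contDiff_of_mem_C0 hf) (contDiff_of_mem_C0 hg),
    fourierT_sum fun I _ => (integrable_of_mem_C0 (hmem I.1 I.2)).smul _, Finset.sum_apply]
  simp only [fourierT_smul, Pi.smul_apply, smul_eq_mul]

end Action

section ConvolutionProduct

lemma fourierT_mul_fourierT_mem_C0 (f g : funcs d) :
    fourierT (f : E d → ℂ) * fourierT (g : E d → ℂ) ∈ C0 d :=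
  mul_mem_C0 (C0_subset_P0 (fourierT_mem_C0 f.2)) (fourierT_mem_C0 g.2)

/-- Convolution as a bilinear map over the operators, encoded as multiplication in Fourier space. -/
def conv (d : ℕ) : funcs d →ₗ[ops d] funcs d →ₗ[ops d] funcs d :=
  LinearMap.mk₂ (ops d)
    (fun f g => ofFourier _ (fourierT_mul_fourierT_mem_C0 f g))
    (fun f g h => funcs_ext (by simp only [fourierT_ofFourier, fourierT_funcs_add, add_mul]))
    (fun P f g => funcs_ext (by simp [fourierT_ops_smul, mul_assoc]))
    (fun f g h => funcs_ext (by simp only [fourierT_ofFourier, fourierT_funcs_add, mul_add]))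
    (fun P f g => funcs_ext (by simp [fourierT_ops_smul, mul_left_comm]))

lemma fourierT_conv (f g : funcs d) :
    fourierT (conv d f g : E d → ℂ) = fourierT (f : E d → ℂ) * fourierT (g : E d → ℂ) :=
  fourierT_ofFourier _ (fourierT_mul_fourierT_mem_C0 f g)

lemma coe_conv (f g : funcs d) : (conv d f g : E d → ℂ) =
    convolution (f : E d → ℂ) (g : E d → ℂ) (ContinuousLinearMap.mul ℂ ℂ) volume :=
  (convolution_eq_invFourierT f.2 g.2).symm

lemma exists_forall_inv_sechProd_mul_fourierT_mem_C0 (s : Finset (funcs d)) :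
    ∃ a > 0, ∀ f ∈ s, (sechProd d a)⁻¹ * fourierT (f : E d → ℂ) ∈ C0 d :=
  (eventually_mem_nhdsWithin.and ((Filter.eventually_all_finset s).2 fun f _ =>
    eventually_inv_sechProd_mul_mem_C0 (fourierT_mem_C0 f.2))).exists

lemma sechProd_mul_inv_mul {a : ℝ} (ha : 0 < a) (h : E d → ℂ) :
    sechProd d a * ((sechProd d a)⁻¹ * h) = h :=
  funext fun x => mul_inv_cancel_left₀ (sechProd_ne_zero ha x) (h x)

lemma injective_conv_ofFourier_sechProd {a : ℝ} (ha : 0 < a) :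
    Function.Injective (conv d (ofFourier (sechProd d a) (sechProd_mem_C0 ha))) := fun f g hfg => by
  have hmul := congrArg (fun f : funcs d => fourierT (f : E d → ℂ)) hfg
  simp only [fourierT_conv, fourierT_ofFourier] at hmul
  exact funcs_ext (funext fun ξ => mul_left_cancel₀ (sechProd_ne_zero ha ξ) (congrFun hmul ξ))

lemma bijective_lift_conv : Function.Bijective (TensorProduct.lift (conv d)) := by
  refine bijective_lift_of_common_divisor (conv d) (fun s => ?_) fun m => ?_
  · obtain ⟨a, ha, hquot⟩ := exists_forall_inv_sechProd_mul_fourierT_mem_C0 s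
    refine ⟨ofFourier (sechProd d a) (sechProd_mem_C0 ha), fun f hf => ?_,
      injective_conv_ofFourier_sechProd ha⟩
    refine Submodule.mem_span_singleton.2
      ⟨opEquiv d ⟨_, C0_subset_P0 (hquot f hf)⟩, funcs_ext ?_⟩
    rw [fourierT_ops_smul, symbol, RingEquiv.symm_apply_apply, fourierT_ofFourier, mul_comm,
      sechProd_mul_inv_mul ha]
  · obtain ⟨a, ha, hquot⟩ := exists_forall_inv_sechProd_mul_fourierT_mem_C0 {m}
    refine ⟨ofFourier (sechProd d a) (sechProd_mem_C0 ha),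
      ofFourier _ (hquot m (Finset.mem_singleton_self m)), funcs_ext ?_⟩
    rw [fourierT_conv, fourierT_ofFourier, fourierT_ofFourier, sechProd_mul_inv_mul ha]

end ConvolutionProduct

section Setting

/-- The convenient analytical setting in which an operator acts by multiplying the Fourier transform
with its symbol. -/
def setting (d : ℕ) : ConvenientAnalyticalSetting d where
  funcs := funcs d
  smooth _ hf := contDiff_of_mem_C0 hf
  integrable _ hf := integrable_of_mem_C0 hf
  ops := ops d
  poly_mem _ := ⟨_, symbolHom_polySymbol _⟩
  module := opsModule
  linear P c f := funcs_ext (by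
    simp only [fourierT_ops_smul, fourierT_funcs_smul, mul_smul_comm])
  poly_act q f x := by
    rw [coe_ops_smul_of_eq_coe rfl f, Finset.sum_apply,
      MvPolynomial.support_map_of_injective q (algebraMap ℝ ℂ).injective]
    simp only [MvPolynomial.coeff_map]
    rfl
  act_hasSum := exists_nhds_hasSum_ops_smul
  leibniz P := by
    obtain ⟨U, hU, hsum⟩ := exists_nhds_hasSum_ops_smul P
    refine ⟨U, hU, fun f g ξ hξ => (hsum (f * g) ξ hξ).congr_fun fun J => ?_⟩
    rw [NonUnitalSubalgebra.coe_mul, fourierT_multiDeriv_mul f.2 g.2, Finset.mul_sum]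
    refine Finset.sum_congr rfl fun I hI => ?_
    rw [Finset.HasAntidiagonal.mem_antidiagonal.1 hI]
    ring
  tensor := ⟨LinearEquiv.ofBijective (TensorProduct.lift (conv d)) bijective_lift_conv, fun f g =>
    ⟨convolutionExists_of_mem_C0 f.2 g.2, coe_conv f g⟩⟩
  dense _ hg _ hK N _ hη := exists_mem_C0_norm_multiDeriv_sub_lt hg hK N hη

end Setting

end ConvAn

end

theorem mainTheorem10 (d : ℕ) :
    ∃ S : ConvAn.ConvenientAnalyticalSetting d,
      (S.funcs : Set (ConvAn.E d → ℂ)) = ConvAn.funcSpace d ∧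
      (S.ops : Set (MvPowerSeries (Fin d) ℂ)) = ConvAn.opRing d ∧
      ∀ p ∈ ConvAn.P0 d, ∀ P : S.ops,
        (P : MvPowerSeries (Fin d) ℂ) = ConvAn.symbolSeries p →
          ∀ f : S.funcs,
            ((P • f : S.funcs) : ConvAn.E d → ℂ) = ConvAn.pseudoDiff p (f : ConvAn.E d → ℂ) := by
  refine ⟨ConvAn.setting d, ConvAn.funcSpace_eq_C0.symm, ConvAn.opRing_eq_range_symbolHom.symm,
    fun p hp P hP f => ?_⟩
  have hsymbol : ConvAn.symbol P = ⟨p, hp⟩ := ConvAn.symbol_eq hP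
  exact (ConvAn.coe_ops_smul P f).trans (by rw [hsymbol])
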